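/- **Setting.** Let $A$ be a set of visible actions and $Act := A\uplus\{\tau,\mathrm t\}$, with $\tau$ the hidden action and $\mathrm t$ the time-out action. Let $V$ be a countably infinite set of variables. The expressions of $\mathrm{CCSP}_{\mathrm t}^\theta$ are (up to renaming of bound variables) $$E ::= 0 \mid x \mid \alpha.E \mid E+F \mid E\parallel_S F \mid \tau_I(E)\mid \mathcal R(E)\mid \theta_L^U(E)\mid \psi_X(E)\mid \langle y\mid\mathcal S\rangle$$ with $x\in V$, $\alpha\in Act$, $S,I,L,U,X\subseteq A$, $L\subseteq U$, $\mathcal R\subseteq A\times A$ with all sets $\{b\mid (a,b)\in\mathcal R\}$ finite, and $\mathcal S=\{x=\mathcal S_x\mid x\in V_{\mathcal S}\}$ a recursive specification (a possibly infinite set of equations, $V_{\mathcal S}\subseteq V$, each $\mathcal S_x$ an expression), $y\in V_{\mathcal S}$, which binds the variables of $V_{\mathcal S}$. $\theta_X$ abbreviates $\theta_X^X$. An expression $E$ is valid if no variable occurrence is free in $F$ but bound in $E$, for a subexpression $\theta_L^U(F)$ or $\psi_X(F)$ of $E$. A process is a valid expression without free variables. $\langle E\mid\mathcal S\rangle$ denotes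 $E$ with $\langle y\mid\mathcal S\rangle$ substituted for each $y\in V_{\mathcal S}$. The transitions $P\xrightarrow{\alpha}P'$ between processes are given by the following rules, where $\alpha\in Act$, $a,b\in A$, and "$P$ idles under $X$" means that $P$ has no outgoing transition with a label in $X\cup\{\tau\}$: - $\alpha.P\xrightarrow{\alpha}P$. If $P\xrightarrow{\alpha}P'$ then $P+Q\xrightarrow{\alpha}P'$ and $Q+P\xrightarrow{\alpha}P'$. - If $P\xrightarrow{\alpha}P'$, $\alpha\notin S$, then $P\parallel_SQ\xrightarrow{\alpha}P'\parallel_SQ$ and $Q\parallel_SP\xrightarrow{\alpha}Q\parallel_SP'$. If $P\xrightarrow{a}P'$, $Q\xrightarrow{a}Q'$, $a\in S$, then $P\parallel_SQ\xrightarrow{a}P'\parallel_SQ'$. - If $P\xrightarrow{\alpha}P'$ then $\tau_I(P)\xrightarrow{\alpha}\tau_I(P')$ when $\alpha\notin I$, and $\tau_I(P)\xrightarrow{\tau}\tau_I(P')$ when $\alpha\in I$. - If $P\xrightarrow{a}P'$, $(a,b)\in\mathcal R$, then $\mathcal R(P)\xrightarrow{b}\mathcal R(P')$. If $P\xrightarrow{\alpha}P'$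 with $\alpha\in\{\tau,\mathrm t\}$ then $\mathcal R(P)\xrightarrow{\alpha}\mathcal R(P')$. - If $P\xrightarrow{\tau}P'$ then $\theta_L^U(P)\xrightarrow{\tau}\theta_L^U(P')$. If $P\xrightarrow{a}P'$, $a\in U$, then $\theta_L^U(P)\xrightarrow{a}P'$. If $P\xrightarrow{\alpha}P'$ and $P$ idles under $L$, then $\theta_L^U(P)\xrightarrow{\alpha}P'$. - If $P\xrightarrow{\alpha}P'$, $\alpha\ne\mathrm t$, then $\psi_X(P)\xrightarrow{\alpha}P'$. If $P\xrightarrow{\mathrm t}P'$ and $P$ idles under $X$, then $\psi_X(P)\xrightarrow{\mathrm t}\theta_X(P')$. - If $\langle\mathcal S_x\mid\mathcal S\rangle\xrightarrow{\alpha}P'$ then $\langle x\mid\mathcal S\rangle\xrightarrow{\alpha}P'$. **Guardedness.** A free occurrence of a variable in an expression is well-guarded if it lies in a subexpression $\alpha.F$ with $\alpha\in A\cup\{\mathrm t\}$. A recursive specification $\mathcal S$ is manifestly well-guarded if no operator $\tau_I$ occurs in it and all free occurrences of variables $x\in V_{\mathcal S}$ in the expressions $\mathcal S_y$, $y \in V_{\mathcal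 S}$, are well-guarded; it is well-guarded if it can be made manifestly well-guarded by substituting, in each right-hand side $\mathcal S_x$, finitely many times, $\mathcal S_y$ for variables $y\in V_{\mathcal S}$. A process $P$ is strongly guarded if each recursive specification occurring in it is well-guarded and no infinite path of $\tau$-transitions starts in a state reachable from $P$. **Bisimilarity.** Write $\Rightarrow$ for the reflexive-transitive closure of $\xrightarrow{\tau}$, and $P\xrightarrow{(\alpha)}P'$ if $P\xrightarrow{\alpha}P'$ or ($\alpha=\tau$ and $P'=P$). A stability respecting branching bisimulation is a symmetric relation $\mathcal B$ on processes such that $\mathcal B(P,Q)$ implies: (1) if $P\xrightarrow{\alpha}P'$ then there are $Q\Rightarrow Q_1\xrightarrow{(\alpha)}Q_2$ with $\mathcal B(P,Q_1)$ and $\mathcal B(P',Q_2)$; (2) if $P$ has no outgoing $\tau$-transition then $Q\Rightarrow Q_0$ for some $Q_0$ without outgoing $\tau$-transition. $P$ and $Q$ are stability respecting branching bisimilar if some such $\mathcal B$ relates them. $P$ and $Q$ are rooted stability respecting branching bisimilar, $P\leftrightarrow_b^r Q$, if they are related by a symmetric relation $\mathcal B$ such that whenever $\mathcal B(P,Q)$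 and $P\xrightarrow{\alpha}P'$, there is a $Q\xrightarrow{\alpha}Q'$ with $P'$ and $Q'$ stability respecting branching bisimilar. **Axioms.** $Ax^\infty$ consists of the following, for processes $x,y,z,\dots$; sums are finite and the empty sum is $0$. - $x+(y+z)=(x+y)+z$, $\;x+y=y+x$, $\;x+x=x$, $\;x+0=x$. - $\tau_I(0)=0$, $\;\tau_I(x+y)=\tau_I(x)+\tau_I(y)$, $\;\tau_I(\alpha.x)=\alpha.\tau_I(x)$ if $\alpha\notin I$, $\;\tau_I(\alpha.x)=\tau.\tau_I(x)$ if $\alpha\in I$. - $\mathcal R(0)=0$, $\;\mathcal R(x+y)=\mathcal R(x)+\mathcal R(y)$, $\;\mathcal R(\tau.x)=\tau.\mathcal R(x)$, $\;\mathcal R(\mathrm t.x)=\mathrm t.\mathcal R(x)$, $\;\mathcal R(a.x)=\sum_{\{b\mid(a,b)\in\mathcal R\}}b.\mathcal R(x)$. - Expansion: if $P=\sum_{i\in I}\alpha_i.P_i$ and $Q=\sum_{j\in J}\beta_j.Q_j$ then $P\parallel_SQ=\sum_{i\in I,\ \alpha_i\notin S}\alpha_i.(P_i\parallel_SQ)+\sum_{j\in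 J,\ \beta_j\notin S}\beta_j.(P\parallel_SQ_j)+\sum_{i\in I,\,j\in J,\ \alpha_i=\beta_j\in S}\alpha_i.(P_i\parallel_SQ_j)$. - Branching axiom: $\alpha.(\tau.(x+y)+x)=\alpha.(x+y)$. - $\theta_L^U(\sum_{i}\alpha_i.x_i)=\sum_i\alpha_i.x_i$ if all $\alpha_i\notin L\cup\{\tau\}$; $\;\theta_L^U(x+\alpha.y+\beta.z)=\theta_L^U(x+\alpha.y)$ if $\alpha\in L\cup\{\tau\}$, $\beta\notin U\cup\{\tau\}$; $\;\theta_L^U(x+\alpha.y+\beta.z)=\theta_L^U(x+\alpha.y)+\theta_L^U(\beta.z)$ if $\alpha\in L\cup\{\tau\}$, $\beta\in U\cup\{\tau\}$; $\;\theta_L^U(\alpha.x)=\alpha.x$ if $\alpha\neq\tau$; $\;\theta_L^U(\tau.x)=\tau.\theta_L^U(x)$. - $\psi_X(x+\alpha.y)=\psi_X(x)+\alpha.y$ if $\alpha\notin X\cup\{\tau,\mathrm t\}$; $\;\psi_X(x+\alpha.y+\mathrm t.z)=\psi_X(x+\alpha.y)$ if $\alpha\in X\cup\{\tau\}$; $\;\psi_X(x+\alpha.y+\beta.z)=\psi_X(x+\alpha.y)+\beta.z$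 if $\alpha,\beta\in X\cup\{\tau\}$; $\;\psi_X(\alpha.x)=\alpha.x$ if $\alpha\ne\mathrm t$; $\;\psi_X(\sum_i\mathrm t.y_i)=\sum_i\mathrm t.\theta_X(y_i)$. - RDP: $\langle x\mid\mathcal S\rangle=\langle\mathcal S_x\mid\mathcal S\rangle$. - RSP, for well-guarded $\mathcal S$ and $x\in V_{\mathcal S}$: $\mathcal S\Rightarrow x=\langle x\mid\mathcal S\rangle$; that is, for every substitution $\rho$ of processes for variables, if $\rho(y)=\mathcal S_y[\rho]$ for all $y\in V_{\mathcal S}$, then $\rho(x)=\langle x\mid\mathcal S\rangle[\rho]$. $Ax^\infty\vdash P=Q$ means that $P=Q$ is derivable from these axioms by reflexivity, symmetry, transitivity and congruence for the operators $\alpha.\_$, $+$, $\parallel_S$, $\tau_I$, $\mathcal R$, $\theta_L^U$ and $\psi_X$. **Theorem.** Let $P,Q$ be strongly guarded $\mathrm{CCSP}_{\mathrm t}^\theta$ processes. If $P\leftrightarrow_b^r Q$, then $Ax^\infty\vdash P=Q$. -/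

import Mathlib

namespace CCSP

universe u

/-- The actions: visible actions `a ∈ A`, the hidden action `τ` and the time-out action `t`. -/
inductive Act (A : Type u) : Type u
  | vis (a : A) : Act A
  | tau : Act A
  | tout : Act A

/-- The set `X` of visible actions, seen as a set of actions. -/
def Act.ofSet {A : Type u} (X : Set A) : Set (Act A) := Act.vis '' X

/-- The set `X ∪ {τ}`. -/
def Act.withTau {A : Type u} (X : Set A) : Set (Act A) := insert Act.tau (Act.ofSet X)

/-! ### Expressions -/

/-- The expressions with free variables among the elements of `V`.  Bound variables are well scoped,
so that expressions which differ only in the names of bound variables are identified.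
`fix W E y` is `⟨y | E⟩`, where `E` is the recursive specification `{x = E x | x ∈ W}`, whose set `W`
of variables is a set of natural numbers (the variables form a countable set); in `E x`
the variable `Sum.inr z` is the variable `z ∈ W`, and `Sum.inl v` is the variable `v` from outside. -/
inductive Expr (A : Type u) : Type → Type (max u 1)
  | nil {V : Type} : Expr A V
  | var {V : Type} (x : V) : Expr A V
  | pre {V : Type} (α : Act A) (E : Expr A V) : Expr A V
  | add {V : Type} (E F : Expr A V) : Expr A V
  | par {V : Type} (S : Set A) (E F : Expr A V) : Expr A V
  | hide {V : Type} (I : Set A) (E : Expr A V) : Expr A V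
  | ren {V : Type} (R : A → A → Prop) (hR : ∀ a, {b | R a b}.Finite) (E : Expr A V) : Expr A V
  | theta {V : Type} (L U : Set A) (hLU : L ⊆ U) (E : Expr A V) : Expr A V
  | psi {V : Type} (X : Set A) (E : Expr A V) : Expr A V
  | fix {V : Type} (W : Set ℕ) (E : W → Expr A (V ⊕ W)) (y : W) : Expr A V

namespace Expr

variable {A : Type u}

/-- Renaming of the free variables. -/
def rename : {V V' : Type} → (V → V') → Expr A V → Expr A V'
  | _, _, _, nil => nil
  | _, _, f, var x => var (f x)
  | _, _, f, pre α E => pre α (rename f E)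
  | _, _, f, add E F => add (rename f E) (rename f F)
  | _, _, f, par S E F => par S (rename f E) (rename f F)
  | _, _, f, hide I E => hide I (rename f E)
  | _, _, f, ren R hR E => ren R hR (rename f E)
  | _, _, f, theta L U h E => theta L U h (rename f E)
  | _, _, f, psi X E => psi X (rename f E)
  | _, _, f, fix W E y => fix W (fun x => rename (Sum.map f id) (E x)) y

/-- Simultaneous (capture-avoiding) substitution for the free variables: `E[σ]`. -/
def subst : {V V' : Type} → (V → Expr A V') → Expr A V → Expr A V'
  | _, _, _, nil => nil
  | _, _, σ, var x => σ x
  | _, _, σ, pre α E => pre α (subst σ E)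
  | _, _, σ, add E F => add (subst σ E) (subst σ F)
  | _, _, σ, par S E F => par S (subst σ E) (subst σ F)
  | _, _, σ, hide I E => hide I (subst σ E)
  | _, _, σ, ren R hR E => ren R hR (subst σ E)
  | _, _, σ, theta L U h E => theta L U h (subst σ E)
  | _, _, σ, psi X E => psi X (subst σ E)
  | _, _, σ, fix W E y =>
      fix W (fun x => subst (Sum.elim (fun v => rename Sum.inl (σ v)) (fun z => var (Sum.inr z))) (E x)) y

/-- `⟨F | E⟩`: the expression `F` in which each variable `y ∈ W` is replaced by `⟨y | E⟩`. -/
def inst {V : Type} {W : Set ℕ} (E : W → Expr A (V ⊕ W)) (F : Expr A (V ⊕ W)) : Expr A V :=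
  subst (Sum.elim var (fun y => fix W E y)) F

/-- The variable `v` has a free occurrence in the expression. -/
def Occurs : {V : Type} → V → Expr A V → Prop
  | _, _, nil => False
  | _, v, var x => x = v
  | _, v, pre _ E => Occurs v E
  | _, v, add E F => Occurs v E ∨ Occurs v F
  | _, v, par _ E F => Occurs v E ∨ Occurs v F
  | _, v, hide _ E => Occurs v E
  | _, v, ren _ _ E => Occurs v E
  | _, v, theta _ _ _ E => Occurs v E
  | _, v, psi _ E => Occurs v E
  | _, v, fix _ E _ => ∃ x, Occurs (Sum.inl v) (E x)

/-- No argument of an environment operator (`theta` or `psi`) within the expression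
has a free occurrence of a variable that belongs to `B` or is bound within the expression. -/
def ValidRel : {V : Type} → Set V → Expr A V → Prop
  | _, _, nil => True
  | _, _, var _ => True
  | _, B, pre _ E => ValidRel B E
  | _, B, add E F => ValidRel B E ∧ ValidRel B F
  | _, B, par _ E F => ValidRel B E ∧ ValidRel B F
  | _, B, hide _ E => ValidRel B E
  | _, B, ren _ _ E => ValidRel B E
  | _, B, theta _ _ _ E => (∀ v ∈ B, ¬ Occurs v E) ∧ ValidRel B E
  | _, B, psi _ E => (∀ v ∈ B, ¬ Occurs v E) ∧ ValidRel B E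
  | _, B, fix _ E _ => ∀ x, ValidRel (Sum.inl '' B ∪ Set.range Sum.inr) (E x)

/-- Valid expressions: no variable occurrence is free in the argument of an environment operator
but bound in the whole expression. -/
def Valid {V : Type} (E : Expr A V) : Prop := ValidRel ∅ E

/-- No abstraction operator `τ_I` occurs in the expression. -/
def NoHide : {V : Type} → Expr A V → Prop
  | _, nil => True
  | _, var _ => True
  | _, pre _ E => NoHide E
  | _, add E F => NoHide E ∧ NoHide F
  | _, par _ E F => NoHide E ∧ NoHide F
  | _, hide _ _ => False
  | _, ren _ _ E => NoHide E
  | _, theta _ _ _ E => NoHide E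
  | _, psi _ E => NoHide E
  | _, fix _ E _ => ∀ x, NoHide (E x)

/-- The variable `v` has a free occurrence that is not well-guarded, i.e. that does not lie in
a subexpression `α.F` with `α` a visible action or the time-out action. -/
def OccursUnguarded : {V : Type} → V → Expr A V → Prop
  | _, _, nil => False
  | _, v, var x => x = v
  | _, v, pre α E => α = Act.tau ∧ OccursUnguarded v E
  | _, v, add E F => OccursUnguarded v E ∨ OccursUnguarded v F
  | _, v, par _ E F => OccursUnguarded v E ∨ OccursUnguarded v F
  | _, v, hide _ E => OccursUnguarded v E
  | _, v, ren _ _ E => OccursUnguarded v E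
  | _, v, theta _ _ _ E => OccursUnguarded v E
  | _, v, psi _ E => OccursUnguarded v E
  | _, v, fix _ E _ => ∃ x, OccursUnguarded (Sum.inl v) (E x)

end Expr

open _root_.CCSP.Expr

variable {A : Type u}

/-! ### Guardedness -/

open Classical in
/-- The substitution of `E y` for `y`, for all variables `y ∈ S` of the specification `E`. -/
noncomputable def unfoldSubst {V : Type} {W : Set ℕ} (E : W → Expr A (V ⊕ W)) (S : Set W) :
    V ⊕ W → Expr A (V ⊕ W)
  | Sum.inl v => var (Sum.inl v)
  | Sum.inr y => if y ∈ S then E y else var (Sum.inr y)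

/-- `G` arises from `F` by repeated (finitely often) substitution of `E y` for variables `y`. -/
inductive UnfoldsTo {V : Type} {W : Set ℕ} (E : W → Expr A (V ⊕ W)) (F : Expr A (V ⊕ W)) :
    Expr A (V ⊕ W) → Prop
  | refl : UnfoldsTo E F F
  | step {G : Expr A (V ⊕ W)} (S : Set W) :
      UnfoldsTo E F G → UnfoldsTo E F (subst (unfoldSubst E S) G)

/-- A recursive specification is manifestly well-guarded. -/
def ManifestlyWellGuarded {V : Type} {W : Set ℕ} (E : W → Expr A (V ⊕ W)) : Prop :=
  (∀ x, NoHide (E x)) ∧ ∀ x y, ¬ OccursUnguarded (Sum.inr x) (E y)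

/-- A recursive specification is well-guarded: it can be made manifestly well-guarded by repeated
substitution of `E y` for `y` within the terms `E x`. -/
def WellGuarded {V : Type} {W : Set ℕ} (E : W → Expr A (V ⊕ W)) : Prop :=
  ∃ E' : W → Expr A (V ⊕ W), (∀ x, UnfoldsTo E (E x) (E' x)) ∧ ManifestlyWellGuarded E'

/-- Each recursive specification that occurs in the expression is well-guarded. -/
def Guarded : {V : Type} → Expr A V → Prop
  | _, nil => True
  | _, var _ => True
  | _, pre _ E => Guarded E
  | _, add E F => Guarded E ∧ Guarded F
  | _, par _ E F => Guarded E ∧ Guarded F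
  | _, hide _ E => Guarded E
  | _, ren _ _ E => Guarded E
  | _, theta _ _ _ E => Guarded E
  | _, psi _ E => Guarded E
  | _, fix _ E _ => WellGuarded E ∧ ∀ x, Guarded (E x)

/-! ### Operational semantics -/

/-- `init(P) ∩ (X ∪ {τ}) = ∅`, with respect to the transition relation `T`. -/
def Idle (T : Expr A Empty → Act A → Expr A Empty → Prop) (X : Set A) (P : Expr A Empty) : Prop :=
  ∀ α ∈ Act.withTau X, ∀ P', ¬ T P α P'

/-- The rules of the operational semantics, in which the negative premises
are evaluated in the transition relation `T`. -/
inductive Rules (T : Expr A Empty → Act A → Expr A Empty → Prop) :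
    Expr A Empty → Act A → Expr A Empty → Prop
  | pre (α P) : Rules T (pre α P) α P
  | addL {α P P'} (Q) : Rules T P α P' → Rules T (add P Q) α P'
  | addR {α Q Q'} (P) : Rules T Q α Q' → Rules T (add P Q) α Q'
  | renVis {a b P P'} (R hR) : Rules T P (Act.vis a) P' → R a b →
      Rules T (ren R hR P) (Act.vis b) (ren R hR P')
  | renTau {P P'} (R hR) : Rules T P Act.tau P' → Rules T (ren R hR P) Act.tau (ren R hR P')
  | renTout {P P'} (R hR) : Rules T P Act.tout P' → Rules T (ren R hR P) Act.tout (ren R hR P')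
  | parL {α P P' S} (Q) : Rules T P α P' → α ∉ Act.ofSet S →
      Rules T (par S P Q) α (par S P' Q)
  | parR {α Q Q' S} (P) : Rules T Q α Q' → α ∉ Act.ofSet S →
      Rules T (par S P Q) α (par S P Q')
  | sync {a P P' Q Q' S} : Rules T P (Act.vis a) P' → Rules T Q (Act.vis a) Q' → a ∈ S →
      Rules T (par S P Q) (Act.vis a) (par S P' Q')
  | hideOut {α P P' I} : Rules T P α P' → α ∉ Act.ofSet I → Rules T (hide I P) α (hide I P')
  | hideIn {a P P' I} : Rules T P (Act.vis a) P' → a ∈ I → Rules T (hide I P) Act.tau (hide I P')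
  | fix {α P'} {W : Set ℕ} {E : W → Expr A (Empty ⊕ W)} {x : W} :
      Rules T (inst E (E x)) α P' → Rules T (fix W E x) α P'
  | thetaTau {P P' L U} (h) : Rules T P Act.tau P' →
      Rules T (theta L U h P) Act.tau (theta L U h P')
  | thetaVis {a P P' L U} (h) : Rules T P (Act.vis a) P' → a ∈ U →
      Rules T (theta L U h P) (Act.vis a) P'
  | thetaIdle {α P P' L U} (h) : Rules T P α P' → Idle T L P → Rules T (theta L U h P) α P'
  | psi {α P P' X} : Rules T P α P' → α ≠ Act.tout → Rules T (psi X P) α P'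
  | psiTout {P P' X} : Rules T P Act.tout P' → Idle T X P →
      Rules T (psi X P) Act.tout (theta X X subset_rfl P')

/-- The transition relation.  Because of the negative premises, the rules are interpreted by the
well-founded model: `Rules` is antitone in `T`, so that applying it twice is monotone,
and the derivable transitions are the least fixed point of the latter
(the intersection of all pre-fixed points).  On valid closed expressions the rules are stratified,
and this is the unique `T` with `T = Rules T`. -/
def Step (P : Expr A Empty) (α : Act A) (Q : Expr A Empty) : Prop :=
  ∀ T : Expr A Empty → Act A → Expr A Empty → Prop,
    (∀ P₁ β P₂, Rules (Rules T) P₁ β P₂ → T P₁ β P₂) → T P α Q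

/-- Processes: valid closed expressions. -/
def Proc (A : Type u) : Type (max u 1) := {P : Expr A Empty // P.Valid}

/-- The transitions between processes. -/
def Trans (P : Proc A) (α : Act A) (Q : Proc A) : Prop := Step P.1 α Q.1

/-- `Q` is reachable from `P` by a (possibly empty) path of transitions. -/
def Reachable (P Q : Proc A) : Prop :=
  Relation.ReflTransGen (fun P₁ P₂ => ∃ α, Trans P₁ α P₂) P Q

/-- Strongly guarded processes: all recursive specifications are well-guarded, and no infinite
path of `τ`-transitions starts in a reachable state. -/
def StronglyGuarded (P : Proc A) : Prop :=
  Guarded P.1 ∧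
    ¬ ∃ f : ℕ → Proc A, Reachable P (f 0) ∧ ∀ n, Trans (f n) Act.tau (f (n + 1))

/-! ### Bisimilarity -/

/-- A path of `τ`-transitions, possibly empty. -/
def TauPath (P Q : Proc A) : Prop := Relation.ReflTransGen (fun P₁ P₂ => Trans P₁ Act.tau P₂) P Q

/-- `P` has no outgoing `τ`-transition. -/
def Stable (P : Proc A) : Prop := ∀ P', ¬ Trans P Act.tau P'

/-- A transition that may be omitted if it is labelled `τ`. -/
def OptTrans (P : Proc A) (α : Act A) (Q : Proc A) : Prop :=
  (α = Act.tau ∧ P = Q) ∨ Trans P α Q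

/-- Stability respecting branching bisimulations. -/
structure IsBisimulation (R : Proc A → Proc A → Prop) : Prop where
  symm : ∀ P Q, R P Q → R Q P
  sim : ∀ P Q α P', R P Q → Trans P α P' →
    ∃ Q₁ Q₂, TauPath Q Q₁ ∧ OptTrans Q₁ α Q₂ ∧ R P Q₁ ∧ R P' Q₂
  stable : ∀ P Q, R P Q → Stable P → ∃ Q₀, TauPath Q Q₀ ∧ Stable Q₀

/-- Stability respecting branching bisimilarity. -/
def Bisimilar (P Q : Proc A) : Prop := ∃ R, IsBisimulation R ∧ R P Q

/-- Rooted stability respecting branching bisimulations. -/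
structure IsRootedBisimulation (R : Proc A → Proc A → Prop) : Prop where
  symm : ∀ P Q, R P Q → R Q P
  sim : ∀ P Q α P', R P Q → Trans P α P' → ∃ Q', Trans Q α Q' ∧ Bisimilar P' Q'

/-- Rooted stability respecting branching bisimilarity. -/
def RootedBisimilar (P Q : Proc A) : Prop := ∃ R, IsRootedBisimulation R ∧ R P Q

/-! ### Axiomatisation -/

/-- Finite sums; the empty sum is `0`. -/
def sum {V : Type} (l : List (Expr A V)) : Expr A V := l.foldr add nil

/-- Finite sums `∑ αᵢ.Pᵢ`. -/
def preSum {V : Type} (l : List (Act A × Expr A V)) : Expr A V :=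
  sum (l.map fun p => pre p.1 p.2)

open Classical in
/-- The right-hand side of the expansion theorem for
`P = ∑_{i ∈ I} αᵢ.Pᵢ` and `Q = ∑_{j ∈ J} βⱼ.Qⱼ`. -/
noncomputable def expansion {V : Type} (S : Set A) (I J : List (Act A × Expr A V)) : Expr A V :=
  add (add
    (sum ((I.filter fun p => p.1 ∉ Act.ofSet S).map fun p => pre p.1 (par S p.2 (preSum J))))
    (sum ((J.filter fun q => q.1 ∉ Act.ofSet S).map fun q => pre q.1 (par S (preSum I) q.2))))
    (sum (((I.product J).filter fun r => r.1.1 = r.2.1 ∧ r.1.1 ∈ Act.ofSet S).map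
      fun r => pre r.1.1 (par S r.1.2 r.2.2)))

/-- The closed instances of the unconditional equations of the axiom system `Ax^∞`. -/
inductive Ax : Expr A Empty → Expr A Empty → Prop
  | add_assoc (x y z) : Ax (add x (add y z)) (add (add x y) z)
  | add_comm (x y) : Ax (add x y) (add y x)
  | add_idem (x) : Ax (add x x) x
  | add_nil (x) : Ax (add x nil) x
  | hide_nil (I) : Ax (hide I nil) nil
  | hide_add (I x y) : Ax (hide I (add x y)) (add (hide I x) (hide I y))
  | hide_out (I α x) : α ∉ Act.ofSet I → Ax (hide I (pre α x)) (pre α (hide I x))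
  | hide_in (I α x) : α ∈ Act.ofSet I → Ax (hide I (pre α x)) (pre Act.tau (hide I x))
  | ren_nil (R hR) : Ax (ren R hR nil) nil
  | ren_add (R hR x y) : Ax (ren R hR (add x y)) (add (ren R hR x) (ren R hR y))
  | ren_tau (R hR x) : Ax (ren R hR (pre Act.tau x)) (pre Act.tau (ren R hR x))
  | ren_tout (R hR x) : Ax (ren R hR (pre Act.tout x)) (pre Act.tout (ren R hR x))
  /-- `l` enumerates the finite set `{b | R a b}`. -/
  | ren_vis (R hR a x) (l : List A) : (∀ b, b ∈ l ↔ R a b) →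
      Ax (ren R hR (pre (Act.vis a) x)) (preSum (l.map fun b => (Act.vis b, ren R hR x)))
  | expansion (S) (I J : List (Act A × Expr A Empty)) :
      Ax (par S (preSum I) (preSum J)) (expansion S I J)
  | branching (α x y) : Ax (pre α (add (pre Act.tau (add x y)) x)) (pre α (add x y))
  | rdp (W : Set ℕ) (E : W → Expr A (Empty ⊕ W)) (x : W) : Ax (fix W E x) (inst E (E x))
  | theta_idle (L U h) (l : List (Act A × Expr A Empty)) :
      (∀ p ∈ l, p.1 ∉ Act.withTau L) → Ax (theta L U h (preSum l)) (preSum l)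
  | theta_drop (L U h α β x y z) : α ∈ Act.withTau L → β ∉ Act.withTau U →
      Ax (theta L U h (add (add x (pre α y)) (pre β z))) (theta L U h (add x (pre α y)))
  | theta_split (L U h α β x y z) : α ∈ Act.withTau L → β ∈ Act.withTau U →
      Ax (theta L U h (add (add x (pre α y)) (pre β z)))
        (add (theta L U h (add x (pre α y))) (theta L U h (pre β z)))
  | theta_pre (L U h α x) : α ≠ Act.tau → Ax (theta L U h (pre α x)) (pre α x)
  | theta_tau (L U h x) : Ax (theta L U h (pre Act.tau x)) (pre Act.tau (theta L U h x))
  | psi_out (X α x y) : α ∉ Act.withTau X → α ≠ Act.tout →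
      Ax (psi X (add x (pre α y))) (add (psi X x) (pre α y))
  | psi_drop (X α x y z) : α ∈ Act.withTau X →
      Ax (psi X (add (add x (pre α y)) (pre Act.tout z))) (psi X (add x (pre α y)))
  | psi_split (X α β x y z) : α ∈ Act.withTau X → β ∈ Act.withTau X →
      Ax (psi X (add (add x (pre α y)) (pre β z))) (add (psi X (add x (pre α y))) (pre β z))
  | psi_pre (X α x) : α ≠ Act.tout → Ax (psi X (pre α x)) (pre α x)
  | psi_tout (X) (l : List (Expr A Empty)) :
      Ax (psi X (preSum (l.map fun y => (Act.tout, y))))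
        (preSum (l.map fun y => (Act.tout, theta X X subset_rfl y)))

/-- `Ax^∞ ⊢ P = Q` for processes `P` and `Q`: derivability in equational logic from the axioms,
including the conditional axiom RSP.  Only valid expressions take part in derivations. -/
inductive Derives : Expr A Empty → Expr A Empty → Prop
  | ax {P Q} : P.Valid → Q.Valid → Ax P Q → Derives P Q
  | refl {P} : P.Valid → Derives P P
  | symm {P Q} : Derives P Q → Derives Q P
  | trans {P Q R} : Derives P Q → Derives Q R → Derives P R
  | pre {P Q} (α) : Derives P Q → Derives (pre α P) (pre α Q)
  | add {P P' Q Q'} : Derives P P' → Derives Q Q' → Derives (add P Q) (add P' Q')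
  | par {P P' Q Q'} (S) : Derives P P' → Derives Q Q' → Derives (par S P Q) (par S P' Q')
  | hide {P Q} (I) : Derives P Q → Derives (hide I P) (hide I Q)
  | ren {P Q} (R hR) : Derives P Q → Derives (ren R hR P) (ren R hR Q)
  | theta {P Q} (L U h) : Derives P Q → Derives (theta L U h P) (theta L U h Q)
  | psi {P Q} (X) : Derives P Q → Derives (psi X P) (psi X Q)
  /-- RSP: if the `ρ y` solve the well-guarded specification `E` (whose further free variables are
  instantiated by `σ`), then `ρ x` equals `⟨x | E⟩`. -/
  | rsp {W : Set ℕ} (E : W → Expr A (ℕ ⊕ W)) (σ : ℕ → Expr A Empty) (ρ : W → Expr A Empty) (x : W) :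
      (∀ y, (fix W E y).Valid) → WellGuarded E → (∀ n, (σ n).Valid) →
      (∀ y, Derives (ρ y) (subst (Sum.elim σ ρ) (E y))) →
      Derives (ρ x) (subst σ (fix W E x))

end CCSP

/-! Guardedness bounds the unwinding needed to see the first steps of a process, so every state
reachable from a strongly guarded process is derivably equal to a finite sum of prefixes listing
exactly its transitions (`Guarded.exists_preSum`). The countably many states reachable from either
process thus solve one linear specification, with finite sums of prefixed variables as right-hand
sides. It is well-guarded because there are no infinite `τ`-paths (`wellGuarded_linearSpec`), so RSP
makes its solutions unique (`derives_of_solutions`).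

A second solution is built from bisimilarity classes. By descent along `τ`-steps and the stuttering
lemma, each class has a representative without inert `τ`-steps, whose transitions directly match
every non-inert transition of the class (`exists_repr`, `Bisimilar.exists_trans`). The
representatives' transitions define a quotient specification. Let `c w` be its constant for the
class of `w`, and `ρ w` the sum of `α.c v` over the transitions from `w` to `v`. In general `c w`
and `ρ w` agree only below a prefix: `α.c w = α.ρ w`, by the branching axiom. This suffices for `ρ`
to solve the original specification, so each state equals its `ρ w`. Rooted bisimilar states have
the same set of summands in `ρ`, hence are derivably equal
(`IsPresentation.derives_of_rootedBisimilar`). -/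

namespace CCSP

universe u

variable {A : Type u}

/-! ### Substitution calculus: composition, free occurrences, validity and hiding -/

namespace Expr

/-- The substitution `σ` under a binder of the variables in `W`. -/
def lift {V V' : Type} (W : Set ℕ) (σ : V → Expr A V') : V ⊕ W → Expr A (V' ⊕ W) :=
  Sum.elim (fun v => rename Sum.inl (σ v)) (fun z => var (Sum.inr z))

theorem subst_fix {V V' : Type} (σ : V → Expr A V') (W : Set ℕ) (E : W → Expr A (V ⊕ W)) (y : W) :
    subst σ (fix W E y) = fix W (fun x => subst (lift W σ) (E x)) y := rfl

theorem rename_rename {V V' V'' : Type} (f : V → V') (g : V' → V'') (E : Expr A V) :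
    rename g (rename f E) = rename (g ∘ f) E := by
  induction E generalizing V' V'' with
  | fix W E y ih => simp [rename, ih]
  | _ => simp_all [rename]

theorem subst_rename {V V' V'' : Type} (f : V → V') (σ : V' → Expr A V'') (E : Expr A V) :
    subst σ (rename f E) = subst (σ ∘ f) E := by
  induction E generalizing V' V'' with
  | fix W E y ih =>
    simp only [rename, subst_fix, ih]
    congr! 3 with x
    ext (v | z) <;> rfl
  | _ => simp_all [rename, subst]

theorem rename_subst {V V' V'' : Type} (σ : V → Expr A V') (g : V' → V'') (E : Expr A V) :
    rename g (subst σ E) = subst (fun v => rename g (σ v)) E := by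
  induction E generalizing V' V'' with
  | fix W E y ih =>
    simp only [rename, subst_fix, ih]
    congr! 3 with x
    ext (v | z)
    · simp only [lift, Sum.elim_inl, rename_rename]; rfl
    · rfl
  | _ => simp_all [rename, subst]

theorem subst_subst {V V' V'' : Type} (σ : V → Expr A V') (τ : V' → Expr A V'') (E : Expr A V) :
    subst τ (subst σ E) = subst (fun v => subst τ (σ v)) E := by
  induction E generalizing V' V'' with
  | fix W E y ih =>
    simp only [subst_fix, ih]
    congr! 3 with x
    ext (v | z)
    · simp only [lift, Sum.elim_inl, subst_rename, rename_subst]; rfl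
    · rfl
  | _ => simp_all [subst]

theorem subst_var {V : Type} (E : Expr A V) : subst var E = E := by
  induction E with
  | @fix V W E y ih =>
    have : lift W (var : V → Expr A V) = var := by ext (v | z) <;> rfl
    simp only [subst_fix, this, ih]
  | _ => simp_all [subst]

/-- The expressions brought in by `lift W σ` for outer variables mention no variable of `W`, so
instantiating the bound variables leaves them untouched. -/
theorem inst_lift {V V' : Type} {W : Set ℕ} (σ : V → Expr A V') (E : W → Expr A (V ⊕ W))
    (F : Expr A (V ⊕ W)) :
    inst (fun x => subst (lift W σ) (E x)) (subst (lift W σ) F) =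
      subst (Sum.elim σ (fun y => subst σ (fix W E y))) F := by
  rw [inst, subst_subst]
  congr 1
  ext (v | z)
  · simp only [lift, Sum.elim_inl, subst_rename]
    exact subst_var _
  · rfl

theorem occurs_rename {V V' : Type} (f : V → V') (w : V') (E : Expr A V) :
    Occurs w (rename f E) ↔ ∃ v, f v = w ∧ Occurs v E := by
  induction E generalizing V' with
  | nil => simp [rename, Occurs]
  | var x => simp [rename, Occurs]
  | add E F ih ih' => simp only [rename, Occurs, ih, ih']; grind
  | par S E F ih ih' => simp only [rename, Occurs, ih, ih']; grind
  | fix W E y ih =>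
    simp only [rename, Occurs, ih, Sum.exists, Sum.map_inl, Sum.map_inr, Sum.inl.injEq, reduceCtorEq,
      false_and, exists_false, or_false]
    grind
  | _ => simp_all [rename, Occurs]

theorem occurs_subst {V V' : Type} (σ : V → Expr A V') (w : V') (E : Expr A V) :
    Occurs w (subst σ E) ↔ ∃ v, Occurs v E ∧ Occurs w (σ v) := by
  induction E generalizing V' with
  | nil => simp [subst, Occurs]
  | var x => simp [subst, Occurs]
  | add E F ih ih' => simp only [subst, Occurs, ih, ih']; grind
  | par S E F ih ih' => simp only [subst, Occurs, ih, ih']; grind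
  | fix W E y ih =>
    simp only [subst_fix, Occurs, ih, Sum.exists, lift, Sum.elim_inl, Sum.elim_inr, occurs_rename,
      Sum.inl.injEq, reduceCtorEq, and_false, exists_false, or_false, exists_eq_left]
    grind
  | _ => simp_all [subst, Occurs]

theorem validRel_rename {V V' : Type} (f : V → V') (B : Set V') (E : Expr A V) :
    ValidRel B (rename f E) ↔ ValidRel (f ⁻¹' B) E := by
  induction E generalizing V' with
  | theta L U h E ih => simp only [rename, ValidRel, ih, occurs_rename]; grind
  | psi X E ih => simp only [rename, ValidRel, ih, occurs_rename]; grind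
  | fix W E y ih =>
    simp only [rename, ValidRel, ih]
    have : Sum.map f id ⁻¹' (Sum.inl '' B ∪ Set.range Sum.inr) =
        (Sum.inl '' (f ⁻¹' B) ∪ Set.range Sum.inr : Set (_ ⊕ W)) := by
      ext (v | z) <;> simp
    rw [this]
  | _ => simp_all [rename, ValidRel]

/-- A variable of `B'` could enter the argument of an environment operator only through a variable
occurring there; such a variable lies outside `B`, and `hB` then excludes it. -/
theorem ValidRel.subst {V V' : Type} {B : Set V} {B' : Set V'} {σ : V → Expr A V'} {E : Expr A V}
    (hE : ValidRel B E) (hσ : ∀ v, ValidRel B' (σ v))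
    (hB : ∀ v, v ∉ B → ∀ w ∈ B', ¬ Occurs w (σ v)) : ValidRel B' (subst σ E) := by
  induction E generalizing V' with
  | theta L U h E ih =>
    refine ⟨fun w hw => ?_, ih hE.2 hσ hB⟩
    rw [occurs_subst]; rintro ⟨v, hv, hv'⟩
    exact hB v (fun h => hE.1 v h hv) w hw hv'
  | psi X E ih =>
    refine ⟨fun w hw => ?_, ih hE.2 hσ hB⟩
    rw [occurs_subst]; rintro ⟨v, hv, hv'⟩
    exact hB v (fun h => hE.1 v h hv) w hw hv'
  | fix W E y ih =>
    refine fun x => ih x (hE x) ?_ ?_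
    · rintro (v | z)
      · simp only [Sum.elim_inl, validRel_rename]
        convert hσ v
        ext; simp
      · trivial
    · rintro (v | z) hv w hw
      · simp only [Sum.elim_inl, occurs_rename]
        rintro ⟨w, rfl, h⟩
        exact hB v (by simpa using hv) w (by simpa using hw) h
      · simp at hv
  | nil => trivial
  | var x => exact hσ x
  | add E F ih ih' => exact ⟨ih hE.1 hσ hB, ih' hE.2 hσ hB⟩
  | par S E F ih ih' => exact ⟨ih hE.1 hσ hB, ih' hE.2 hσ hB⟩
  | pre α E ih => exact ih hE hσ hB
  | hide I E ih => exact ih hE hσ hB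
  | ren R hR E ih => exact ih hE hσ hB

theorem ValidRel.valid_subst {V V' : Type} {B : Set V} {σ : V → Expr A V'} {E : Expr A V}
    (hE : ValidRel B E) (hσ : ∀ v, Valid (σ v)) : Valid (Expr.subst σ E) :=
  hE.subst hσ (fun _ _ _ h => h.elim)

theorem Valid.inst {W : Set ℕ} {E : W → Expr A (Empty ⊕ W)} {x : W} (h : Valid (fix W E x)) :
    Valid (inst E (E x)) :=
  (h x).valid_subst (by rintro (v | z); exacts [v.elim, h])

theorem noHide_rename {V V' : Type} (f : V → V') (E : Expr A V) :
    NoHide (rename f E) ↔ NoHide E := by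
  induction E generalizing V' with
  | _ => simp_all [rename, NoHide]

theorem NoHide.of_subst {V V' : Type} {σ : V → Expr A V'} {E : Expr A V}
    (h : NoHide (Expr.subst σ E)) : NoHide E := by
  induction E generalizing V' with
  | fix W E y ih => exact fun x => ih x (h x)
  | nil => trivial
  | var x => trivial
  | hide I E ih => exact h.elim
  | add E F ih ih' => exact ⟨ih h.1, ih' h.2⟩
  | par S E F ih ih' => exact ⟨ih h.1, ih' h.2⟩
  | pre α E ih => exact ih h
  | ren R hR E ih => exact ih h
  | theta L U hLU E ih => exact ih h
  | psi X E ih => exact ih h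

theorem NoHide.subst {V V' : Type} {σ : V → Expr A V'} {E : Expr A V}
    (h : NoHide E) (hσ : ∀ v, NoHide (σ v)) : NoHide (Expr.subst σ E) := by
  induction E generalizing V' with
  | fix W E y ih =>
    refine fun x => ih x (h x) ?_
    rintro (v | z)
    · exact (noHide_rename _ _).2 (hσ v)
    · trivial
  | nil => trivial
  | var x => exact hσ x
  | hide I E ih => exact h.elim
  | add E F ih ih' => exact ⟨ih h.1 hσ, ih' h.2 hσ⟩
  | par S E F ih ih' => exact ⟨ih h.1 hσ, ih' h.2 hσ⟩
  | pre α E ih => exact ih h hσ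
  | ren R hR E ih => exact ih h hσ
  | theta L U hLU E ih => exact ih h hσ
  | psi X E ih => exact ih h hσ

theorem occursUnguarded_rename {V V' : Type} (f : V → V') (w : V') (E : Expr A V) :
    OccursUnguarded w (rename f E) ↔ ∃ v, f v = w ∧ OccursUnguarded v E := by
  induction E generalizing V' with
  | nil => simp [rename, OccursUnguarded]
  | var x => simp [rename, OccursUnguarded]
  | add E F ih ih' => simp only [rename, OccursUnguarded, ih, ih']; grind
  | par S E F ih ih' => simp only [rename, OccursUnguarded, ih, ih']; grind
  | pre α E ih => simp only [rename, OccursUnguarded, ih]; grind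
  | fix W E y ih =>
    simp only [rename, OccursUnguarded, ih, Sum.exists, Sum.map_inl, Sum.map_inr, Sum.inl.injEq,
      reduceCtorEq, false_and, exists_false, or_false]
    grind
  | _ => simp_all [rename, OccursUnguarded]

theorem occursUnguarded_subst {V V' : Type} (σ : V → Expr A V') (w : V') (E : Expr A V) :
    OccursUnguarded w (subst σ E) ↔ ∃ v, OccursUnguarded v E ∧ OccursUnguarded w (σ v) := by
  induction E generalizing V' with
  | nil => simp [subst, OccursUnguarded]
  | var x => simp [subst, OccursUnguarded]
  | add E F ih ih' => simp only [subst, OccursUnguarded, ih, ih']; grind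
  | par S E F ih ih' => simp only [subst, OccursUnguarded, ih, ih']; grind
  | pre α E ih => simp only [subst, OccursUnguarded, ih]; grind
  | fix W E y ih =>
    simp only [subst_fix, OccursUnguarded, ih, Sum.exists, lift, Sum.elim_inl, Sum.elim_inr,
      occursUnguarded_rename, Sum.inl.injEq, reduceCtorEq, and_false, exists_false, or_false,
      exists_eq_left]
    grind
  | _ => simp_all [subst, OccursUnguarded]

end Expr

open _root_.CCSP.Expr

/-! ### Guardedness -/

theorem UnfoldsTo.subst_lift {V V' : Type} {W : Set ℕ} {E : W → Expr A (V ⊕ W)}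
    {F G : Expr A (V ⊕ W)} (h : UnfoldsTo E F G) (σ : V → Expr A V') :
    UnfoldsTo (fun x => subst (lift W σ) (E x)) (subst (lift W σ) F) (subst (lift W σ) G) := by
  induction h with
  | refl => exact .refl
  | @step G S _ ih =>
    convert UnfoldsTo.step S ih using 1
    rw [subst_subst, subst_subst]
    congr 1
    ext (v | z)
    -- Only outer variables occur in this term, and unfolding fixes them.
    · change rename Sum.inl (σ v) =
        subst (unfoldSubst (fun x => subst (lift W σ) (E x)) S) (rename Sum.inl (σ v))
      rw [subst_rename]
      change _ = subst (fun v => rename Sum.inl (var v)) (σ v)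
      rw [← rename_subst, subst_var]
    · by_cases hz : z ∈ S <;> simp [unfoldSubst, lift, subst, hz]

theorem UnfoldsTo.noHide {V : Type} {W : Set ℕ} {E : W → Expr A (V ⊕ W)}
    {F G : Expr A (V ⊕ W)} (h : UnfoldsTo E F G) (hG : NoHide G) : NoHide F := by
  induction h with
  | refl => exact hG
  | step S _ ih => exact ih hG.of_subst

/-- Substitution never removes an operator, so an abstraction in `E x` would survive into the
manifestly well-guarded form. -/
theorem WellGuarded.noHide {V : Type} {W : Set ℕ} {E : W → Expr A (V ⊕ W)} (h : WellGuarded E)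
    (x : W) : NoHide (E x) := by
  obtain ⟨E', h, hE', -⟩ := h
  exact (h x).noHide (hE' x)

/-- The substituted terms contain no variable of `W`, so they cannot spoil guardedness; only an
abstraction operator could, which is what `hσ` rules out. -/
theorem WellGuarded.subst_lift {V V' : Type} {W : Set ℕ} {E : W → Expr A (V ⊕ W)}
    (h : WellGuarded E) {σ : V → Expr A V'} (hσ : ∀ v, NoHide (σ v)) :
    WellGuarded (fun x => subst (lift W σ) (E x)) := by
  obtain ⟨E', h, hE', hg⟩ := h
  refine ⟨fun x => subst (lift W σ) (E' x), fun x => (h x).subst_lift σ,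
    fun x => (hE' x).subst ?_, fun x y => ?_⟩
  · rintro (v | z)
    · exact (noHide_rename _ _).2 (hσ v)
    · trivial
  · rw [occursUnguarded_subst]
    rintro ⟨v | z, h₁, h₂⟩
    · simp [lift, occursUnguarded_rename] at h₂
    · simp only [lift, Sum.elim_inr, OccursUnguarded, Sum.inr.injEq] at h₂
      exact hg x y (h₂ ▸ h₁)

theorem wellGuarded_rename {V V' : Type} {W : Set ℕ} {E : W → Expr A (V ⊕ W)}
    (h : WellGuarded E) (f : V → V') :
    WellGuarded (fun x => rename (Sum.map f id) (E x)) := by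
  convert h.subst_lift (σ := fun v => var (f v)) (fun _ => trivial) using 2 with x
  have : lift W (fun v => var (f v)) = fun v => rename (Sum.map f id) (var v : Expr A (V ⊕ W)) := by
    ext (v | z) <;> rfl
  rw [this, ← rename_subst, subst_var]

theorem Guarded.rename {V V' : Type} {E : Expr A V} (h : Guarded E) (f : V → V') :
    Guarded (Expr.rename f E) := by
  induction E generalizing V' with
  | fix W E y ih => exact ⟨wellGuarded_rename h.1 f, fun x => ih x (h.2 x) _⟩
  | nil => trivial
  | var x => trivial
  | hide I E ih => exact ih h f
  | add E F ih ih' => exact ⟨ih h.1 f, ih' h.2 f⟩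
  | par S E F ih ih' => exact ⟨ih h.1 f, ih' h.2 f⟩
  | pre α E ih => exact ih h f
  | ren R hR E ih => exact ih h f
  | theta L U hLU E ih => exact ih h f
  | psi X E ih => exact ih h f

theorem Guarded.subst {V V' : Type} {E : Expr A V} (h : Guarded E) {σ : V → Expr A V'}
    (hσ : ∀ v, Guarded (σ v)) (hσ' : ∀ v, NoHide (σ v)) : Guarded (Expr.subst σ E) := by
  induction E generalizing V' with
  | fix W E y ih =>
    refine ⟨h.1.subst_lift hσ', fun x => ih x (h.2 x) ?_ ?_⟩
    · rintro (v | z)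
      · exact (hσ v).rename _
      · trivial
    · rintro (v | z)
      · exact (noHide_rename _ _).2 (hσ' v)
      · trivial
  | nil => trivial
  | var x => exact hσ x
  | hide I E ih => exact ih h hσ hσ'
  | add E F ih ih' => exact ⟨ih h.1 hσ hσ', ih' h.2 hσ hσ'⟩
  | par S E F ih ih' => exact ⟨ih h.1 hσ hσ', ih' h.2 hσ hσ'⟩
  | pre α E ih => exact ih h hσ hσ'
  | ren R hR E ih => exact ih h hσ hσ'
  | theta L U hLU E ih => exact ih h hσ hσ'
  | psi X E ih => exact ih h hσ hσ'

/-- The constants substituted here may land inside inner specifications, which must stay free of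
abstraction; `WellGuarded.noHide` guarantees this. -/
theorem Guarded.inst {W : Set ℕ} {E : W → Expr A (Empty ⊕ W)} {x : W} (h : Guarded (fix W E x)) :
    Guarded (inst E (E x)) := by
  refine (h.2 x).subst ?_ ?_
  · rintro (v | z); exacts [v.elim, h]
  · rintro (v | z); exacts [v.elim, h.1.noHide]

/-- Closed expressions whose outgoing transitions can be computed by finitely many unfoldings of
recursive specifications. -/
inductive Unwindable : Expr A Empty → Prop
  | nil : Unwindable .nil
  | pre (α P) : Unwindable (.pre α P)
  | add {P Q} : Unwindable P → Unwindable Q → Unwindable (.add P Q)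
  | par (S) {P Q} : Unwindable P → Unwindable Q → Unwindable (.par S P Q)
  | hide (I) {P} : Unwindable P → Unwindable (.hide I P)
  | ren (R hR) {P} : Unwindable P → Unwindable (.ren R hR P)
  | theta (L U h) {P} : Unwindable P → Unwindable (.theta L U h P)
  | psi (X) {P} : Unwindable P → Unwindable (.psi X P)
  | fix {W : Set ℕ} {E : W → Expr A (Empty ⊕ W)} {x : W} :
      Unwindable (Expr.inst E (E x)) → Unwindable (.fix W E x)

/-- Backward induction along the unfolding: an unguarded variable either survives a step, or is
replaced by its right-hand side, whose unguarded variables are then unguarded in the result, so that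
`hp` applies. It is used with a manifestly well-guarded `G`, where `hG` is vacuous. -/
theorem UnfoldsTo.forall_of_forall {V : Type} {W : Set ℕ} {E : W → Expr A (V ⊕ W)} {p : W → Prop}
    (hp : ∀ z, (∀ w, OccursUnguarded (Sum.inr w) (E z) → p w) → p z)
    {F G : Expr A (V ⊕ W)} (h : UnfoldsTo E F G)
    (hG : ∀ w, OccursUnguarded (Sum.inr w) G → p w) :
    ∀ w, OccursUnguarded (Sum.inr w) F → p w := by
  induction h with
  | refl => exact hG
  | step S _ ih =>
    refine ih fun z hz => ?_
    simp only [occursUnguarded_subst] at hG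
    by_cases hS : z ∈ S
    · exact hp z fun w hw => hG w ⟨_, hz, by simpa [unfoldSubst, hS] using hw⟩
    · exact hG z ⟨_, hz, by simp [unfoldSubst, hS, OccursUnguarded]⟩

/-- Unwinding stops at any prefix, so nothing needs to be known about `σ` on well-guarded variables.
This is what makes structural induction go through at a recursion. -/
theorem Guarded.unwindable_subst {V : Type} {E : Expr A V} (h : Guarded E) {σ : V → Expr A Empty}
    (hσ : ∀ v, OccursUnguarded v E → Unwindable (σ v)) : Unwindable (Expr.subst σ E) := by
  induction E with
  | fix W E y ih =>
    have key : ∀ z, (∀ w, OccursUnguarded (Sum.inr w) (E z) →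
        Unwindable (Expr.subst σ (.fix W E w))) → Unwindable (Expr.subst σ (.fix W E z)) := by
      intro z hz
      refine .fix ?_
      change Unwindable (Expr.inst (fun x => Expr.subst (lift W σ) (E x))
        (Expr.subst (lift W σ) (E z)))
      rw [inst_lift]
      refine ih z (h.2 z) ?_
      rintro (v | w) hw
      · exact hσ v ⟨z, hw⟩
      · exact hz w hw
    obtain ⟨⟨E', hE', hm⟩, -⟩ := h
    -- The manifest form of the equation for `y` has no unguarded variables; going back along the
    -- unfolding settles those of `E y`, and `key` then settles `y`.
    exact key y ((hE' y).forall_of_forall key fun w hw => (hm.2 w y hw).elim)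
  | nil => exact .nil
  | var x => exact hσ x rfl
  | pre α E ih => exact .pre _ _
  | hide I E ih => exact .hide _ (ih h hσ)
  | add E F ih ih' =>
    exact .add (ih h.1 fun v hv => hσ v (.inl hv)) (ih' h.2 fun v hv => hσ v (.inr hv))
  | par S E F ih ih' =>
    exact .par _ (ih h.1 fun v hv => hσ v (.inl hv)) (ih' h.2 fun v hv => hσ v (.inr hv))
  | ren R hR E ih => exact .ren _ _ (ih h hσ)
  | theta L U hLU E ih => exact .theta _ _ _ (ih h hσ)
  | psi X E ih => exact .psi _ (ih h hσ)

theorem Guarded.unwindable {P : Expr A Empty} (h : Guarded P) : Unwindable P := by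
  simpa [subst_var] using h.unwindable_subst (σ := Expr.var) (fun v => v.elim)

/-! ### Equational reasoning with sums -/

theorem Derives.valid {P Q : Expr A Empty} (h : Derives P Q) : P.Valid ∧ Q.Valid := by
  induction h with
  | ax h₁ h₂ _ => exact ⟨h₁, h₂⟩
  | refl h => exact ⟨h, h⟩
  | symm _ ih => exact ih.symm
  | trans _ _ ih₁ ih₂ => exact ⟨ih₁.1, ih₂.2⟩
  | pre _ _ ih => exact ih
  | add _ _ ih₁ ih₂ => exact ⟨⟨ih₁.1, ih₂.1⟩, ⟨ih₁.2, ih₂.2⟩⟩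
  | par _ _ _ ih₁ ih₂ => exact ⟨⟨ih₁.1, ih₂.1⟩, ⟨ih₁.2, ih₂.2⟩⟩
  | hide _ _ ih => exact ih
  | ren _ _ _ ih => exact ih
  | theta _ _ _ _ ih => exact ⟨⟨fun _ h => h.elim, ih.1⟩, ⟨fun _ h => h.elim, ih.2⟩⟩
  | psi _ _ ih => exact ⟨⟨fun _ h => h.elim, ih.1⟩, ⟨fun _ h => h.elim, ih.2⟩⟩
  | rsp E σ ρ x hE _ hσ _ ih =>
    exact ⟨(ih x).1, (hE x : ValidRel ∅ _).valid_subst hσ⟩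

theorem valid_add {P Q : Expr A Empty} (hP : P.Valid) (hQ : Q.Valid) : (add P Q).Valid := ⟨hP, hQ⟩

theorem valid_pre {P : Expr A Empty} (h : P.Valid) (α : Act A) : (pre α P).Valid := h

theorem valid_hide {P : Expr A Empty} (h : P.Valid) (I : Set A) : (hide I P).Valid := h

theorem valid_ren {P : Expr A Empty} (h : P.Valid) (R : A → A → Prop) (hR) :
    (ren R hR P).Valid := h

theorem valid_theta {P : Expr A Empty} (h : P.Valid) (L U : Set A) (hLU : L ⊆ U) :
    (theta L U hLU P).Valid := ⟨fun _ h => h.elim, h⟩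

theorem valid_psi {P : Expr A Empty} (h : P.Valid) (X : Set A) : (Expr.psi X P).Valid :=
  ⟨fun _ h => h.elim, h⟩

theorem valid_sum {V : Type} {l : List (Expr A V)} (h : ∀ p ∈ l, p.Valid) : (sum l).Valid := by
  induction l with
  | nil => trivial
  | cons p l ih => exact ⟨h p (by simp), ih fun q hq => h q (by simp [hq])⟩

theorem valid_preSum {V : Type} {l : List (Act A × Expr A V)} (h : ∀ p ∈ l, p.2.Valid) :
    (preSum l).Valid :=
  valid_sum (List.forall_mem_map.2 h)

namespace Derives

theorem add_comm {P Q : Expr A Empty} (hP : P.Valid) (hQ : Q.Valid) :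
    Derives (.add P Q) (.add Q P) := .ax ⟨hP, hQ⟩ ⟨hQ, hP⟩ (.add_comm _ _)

theorem add_assoc {P Q R : Expr A Empty} (hP : P.Valid) (hQ : Q.Valid) (hR : R.Valid) :
    Derives (.add (.add P Q) R) (.add P (.add Q R)) :=
  .symm (.ax ⟨hP, hQ, hR⟩ ⟨⟨hP, hQ⟩, hR⟩ (.add_assoc _ _ _))

theorem add_right_comm {P Q R : Expr A Empty} (hP : P.Valid) (hQ : Q.Valid) (hR : R.Valid) :
    Derives (.add (.add P Q) R) (.add (.add P R) Q) :=
  (add_assoc hP hQ hR).trans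
    ((Derives.add (.refl hP) (add_comm hQ hR)).trans (add_assoc hP hR hQ).symm)

theorem add_idem {P : Expr A Empty} (hP : P.Valid) : Derives (.add P P) P :=
  .ax ⟨hP, hP⟩ hP (.add_idem _)

theorem add_nil {P : Expr A Empty} (hP : P.Valid) : Derives (.add P .nil) P :=
  .ax ⟨hP, trivial⟩ hP (.add_nil _)

theorem nil_add {P : Expr A Empty} (hP : P.Valid) : Derives (.add .nil P) P :=
  have h : (Expr.nil : Expr A Empty).Valid := trivial
  (add_comm h hP).trans (add_nil hP)

end Derives

/-- `P` is a summand of `Q`, up to derivable equality. -/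
def Summand (P Q : Expr A Empty) : Prop := Derives (.add Q P) Q

namespace Summand

variable {P Q R : Expr A Empty}

theorem valid (h : Summand P Q) : P.Valid ∧ Q.Valid := ⟨(Derives.valid h).1.2, (Derives.valid h).2⟩

theorem of_derives (h : Derives P Q) : Summand P Q :=
  (Derives.add (.refl h.valid.2) h).trans (.add_idem h.valid.2)

/-- Both sides equal `P + Q`. Equalities between sums are proved below as two inclusions. -/
theorem antisymm (h₁ : Summand P Q) (h₂ : Summand Q P) : Derives P Q :=
  (h₂.symm.trans (.add_comm h₁.valid.1 h₁.valid.2)).trans h₁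

theorem trans (h₁ : Summand P Q) (h₂ : Summand Q R) : Summand P R :=
  have hP := h₁.valid.1
  have hQ := h₁.valid.2
  have hR := h₂.valid.2
  (Derives.add (Derives.symm h₂) (.refl hP)).trans <| (Derives.add_assoc hR hQ hP).trans <|
    (Derives.add (.refl hR) h₁).trans h₂

theorem add (h₁ : Summand P R) (h₂ : Summand Q R) : Summand (.add P Q) R :=
  (Derives.add_assoc h₁.valid.2 h₁.valid.1 h₂.valid.1).symm.trans <|
    (Derives.add h₁ (.refl h₂.valid.1)).trans h₂

theorem left (hP : P.Valid) (hQ : Q.Valid) : Summand P (.add P Q) :=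
  (Derives.add_right_comm hP hQ hP).trans (Derives.add (.add_idem hP) (.refl hQ))

theorem right (hP : P.Valid) (hQ : Q.Valid) : Summand Q (.add P Q) :=
  (Derives.add_assoc hP hQ hQ).trans (Derives.add (.refl hP) (.add_idem hQ))

theorem sum {l : List (Expr A Empty)} (hQ : Q.Valid) (h : ∀ p ∈ l, Summand p Q) :
    Summand (sum l) Q := by
  induction l with
  | nil => exact .add_nil hQ
  | cons p l ih => exact (h p (by simp)).add (ih fun q hq => h q (by simp [hq]))

theorem of_mem {l : List (Expr A Empty)} (h : ∀ p ∈ l, p.Valid) (hP : P ∈ l) :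
    Summand P (CCSP.sum l) := by
  induction l with
  | nil => simp at hP
  | cons p l ih =>
    have hp := h p (by simp)
    have hl : ∀ q ∈ l, q.Valid := fun q hq => h q (by simp [hq])
    rcases List.mem_cons.1 hP with rfl | hP
    · exact left hp (valid_sum hl)
    · exact (ih hl hP).trans (right hp (valid_sum hl))

theorem of_mem_preSum {l : List (Act A × Expr A Empty)} (h : ∀ p ∈ l, p.2.Valid)
    {p : Act A × Expr A Empty} (hp : p ∈ l) : Summand (.pre p.1 p.2) (preSum l) :=
  of_mem (List.forall_mem_map.2 h)
    (List.mem_map.2 ⟨p, hp, rfl⟩)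

end Summand

/-- Up to derivability a sum depends only on the set of its summands, so order and multiplicity in
lists are irrelevant. -/
theorem derives_sum {l m : List (Expr A Empty)} (h₁ : ∀ p ∈ l, ∃ q ∈ m, Derives p q)
    (h₂ : ∀ q ∈ m, ∃ p ∈ l, Derives p q) : Derives (sum l) (sum m) := by
  have hl : ∀ p ∈ l, p.Valid := fun p hp => let ⟨_, _, h⟩ := h₁ p hp; h.valid.1
  have hm : ∀ p ∈ m, p.Valid := fun p hp => let ⟨_, _, h⟩ := h₂ p hp; h.valid.2
  refine Summand.antisymm (.sum (valid_sum hm) fun p hp => ?_) (.sum (valid_sum hl) fun p hp => ?_)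
  · obtain ⟨q, hq, h⟩ := h₁ p hp
    exact (Summand.of_derives h).trans (.of_mem hm hq)
  · obtain ⟨q, hq, h⟩ := h₂ p hp
    exact (Summand.of_derives h.symm).trans (.of_mem hl hq)

theorem derives_sum_map {ι : Type*} {l : List ι} {f g : ι → Expr A Empty}
    (h : ∀ i ∈ l, Derives (f i) (g i)) : Derives (sum (l.map f)) (sum (l.map g)) :=
  derives_sum (List.forall_mem_map.2 fun i hi => ⟨g i, List.mem_map_of_mem hi, h i hi⟩)
    (List.forall_mem_map.2 fun i hi => ⟨f i, List.mem_map_of_mem hi, h i hi⟩)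

theorem derives_sum_append {l m : List (Expr A Empty)} (hl : ∀ p ∈ l, p.Valid)
    (hm : ∀ p ∈ m, p.Valid) : Derives (CCSP.sum (l ++ m)) (.add (CCSP.sum l) (CCSP.sum m)) := by
  induction l with
  | nil => exact (Derives.nil_add (valid_sum hm)).symm
  | cons p l ih =>
    have hp := hl p (by simp)
    have hl : ∀ q ∈ l, q.Valid := fun q hq => hl q (by simp [hq])
    exact (Derives.add (.refl hp) (ih hl)).trans
      (Derives.add_assoc hp (valid_sum hl) (valid_sum hm)).symm

theorem derives_preSum_append {l m : List (Act A × Expr A Empty)} (hl : ∀ p ∈ l, p.2.Valid)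
    (hm : ∀ p ∈ m, p.2.Valid) : Derives (preSum (l ++ m)) (.add (preSum l) (preSum m)) := by
  rw [preSum, List.map_append]
  exact derives_sum_append (List.forall_mem_map.2 hl) (List.forall_mem_map.2 hm)

/-! ### Operators applied to sums -/

section Sums

variable {l : List (Act A × Expr A Empty)}

open Classical in
/-- The summand of `τ_I(P)` that stems from a summand of `P`. -/
noncomputable def hideSummand (I : Set A) (p : Act A × Expr A Empty) : Act A × Expr A Empty :=
  (if p.1 ∈ Act.ofSet I then .tau else p.1, .hide I p.2)

theorem derives_hide_preSum (I : Set A) (hl : ∀ p ∈ l, p.2.Valid) :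
    Derives (.hide I (preSum l)) (preSum (l.map (hideSummand I))) := by
  induction l with
  | nil => exact .ax trivial trivial (.hide_nil I)
  | cons p l ih =>
    have hp : (Expr.pre p.1 p.2).Valid := hl p (by simp)
    have hl : ∀ q ∈ l, q.2.Valid := fun q hq => hl q (by simp [hq])
    refine .trans (.ax (valid_hide (valid_add hp (valid_preSum hl)) I)
      (valid_add (valid_hide hp I) (valid_hide (valid_preSum hl) I))
      (.hide_add _ (.pre p.1 p.2) _)) ?_
    refine .add ?_ (ih hl)
    by_cases h : p.1 ∈ Act.ofSet I
    · rw [hideSummand, if_pos h]; exact .ax hp hp (.hide_in _ _ _ h)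
    · rw [hideSummand, if_neg h]; exact .ax hp hp (.hide_out _ _ _ h)

/-- The summands of `R(P)` that stem from a summand of `P`. -/
noncomputable def renSummands (R : A → A → Prop) (hR : ∀ a, {b | R a b}.Finite) :
    Act A × Expr A Empty → List (Act A × Expr A Empty)
  | (.vis a, x) => (hR a).toFinset.toList.map fun b => (.vis b, .ren R hR x)
  | (.tau, x) => [(.tau, .ren R hR x)]
  | (.tout, x) => [(.tout, .ren R hR x)]

theorem valid_renSummands (R : A → A → Prop) (hR) (p : Act A × Expr A Empty) (hp : p.2.Valid) :
    ∀ q ∈ renSummands R hR p, q.2.Valid := by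
  obtain ⟨a | _ | _, x⟩ := p
  · simpa [renSummands] using fun _ _ => valid_ren hp R hR
  · simpa [renSummands] using valid_ren hp R hR
  · simpa [renSummands] using valid_ren hp R hR

theorem derives_ren_preSum (R : A → A → Prop) (hR) (hl : ∀ p ∈ l, p.2.Valid) :
    Derives (.ren R hR (preSum l)) (preSum (l.flatMap (renSummands R hR))) := by
  induction l with
  | nil => exact .ax trivial trivial (.ren_nil R hR)
  | cons p l ih =>
    have hp : (Expr.pre p.1 p.2).Valid := hl p (by simp)
    have hl : ∀ q ∈ l, q.2.Valid := fun q hq => hl q (by simp [hq])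
    have hm : ∀ q ∈ l.flatMap (renSummands R hR), q.2.Valid := by
      intro q hq
      obtain ⟨p, hp, hq⟩ := List.mem_flatMap.1 hq
      exact valid_renSummands R hR p (hl p hp) q hq
    refine .trans (.ax (valid_ren (valid_add hp (valid_preSum hl)) R hR)
      (valid_add (valid_ren hp R hR) (valid_ren (valid_preSum hl) R hR))
      (.ren_add _ _ (.pre p.1 p.2) _)) ?_
    rw [List.flatMap_cons]
    refine .trans ?_ (derives_preSum_append (valid_renSummands R hR p hp) hm).symm
    refine .add ?_ (ih hl)
    have hv := valid_preSum (valid_renSummands R hR p hp)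
    obtain ⟨a | _ | _, x⟩ := p
    · exact .ax hp hv (.ren_vis _ _ _ _ _ (by simp))
    · exact .trans (.ax hp (valid_pre (valid_ren (P := x) hp R hR) .tau) (.ren_tau R hR x)) (Derives.add_nil (P := .pre .tau (.ren R hR x)) hp).symm
    · exact .trans (.ax hp (valid_pre (valid_ren (P := x) hp R hR) .tout) (.ren_tout R hR x)) (Derives.add_nil (P := .pre .tout (.ren R hR x)) hp).symm

open Classical in
/-- The summand of `θ(P)` that stems from a summand of `P`. -/
noncomputable def thetaSummand (L U : Set A) (h : L ⊆ U) (p : Act A × Expr A Empty) :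
    Act A × Expr A Empty :=
  (p.1, if p.1 = .tau then .theta L U h p.2 else p.2)

theorem derives_theta_pre (L U : Set A) (h : L ⊆ U) (p : Act A × Expr A Empty) (hp : p.2.Valid) :
    Derives (.theta L U h (.pre p.1 p.2))
      (.pre (thetaSummand L U h p).1 (thetaSummand L U h p).2) := by
  obtain ⟨α, x⟩ := p
  by_cases hα : α = .tau
  · subst hα
    simp only [thetaSummand, if_true]
    exact .ax (valid_theta hp L U h) (valid_theta hp L U h) (.theta_tau _ _ _ _)
  · simp only [thetaSummand, if_neg hα]
    exact .ax (valid_theta (P := Expr.pre α x) hp L U h) hp (.theta_pre _ _ _ _ _ hα)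

open Classical in
theorem derives_theta_add (L U : Set A) (h : L ⊆ U) (hl : ∀ p ∈ l, p.2.Valid)
    {α : Act A} {x : Expr A Empty} (hx : x.Valid) (hα : α ∈ Act.withTau L) :
    Derives (.theta L U h (.add (preSum l) (.pre α x)))
      (.add (sum ((l.filter fun p => p.1 ∈ Act.withTau U).map
        fun p => .theta L U h (.pre p.1 p.2))) (.theta L U h (.pre α x))) := by
  have hx' : (Expr.pre α x).Valid := hx
  induction l with
  | nil =>
    exact .trans (.theta _ _ _ (.nil_add hx')) (Derives.nil_add (valid_theta hx' L U h)).symm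
  | cons p l ih =>
    have hp : (Expr.pre p.1 p.2).Valid := hl p (by simp)
    have hl : ∀ q ∈ l, q.2.Valid := fun q hq => hl q (by simp [hq])
    have hl' := valid_preSum hl
    have ih := ih hl
    -- The axioms that split off or drop a summand need `α.x` present as a witness against idling,
    -- so the summand `p` is moved to the end, behind it.
    refine .trans (.theta _ _ _ ((Derives.add (.add_comm hp hl') (.refl hx')).trans
      (.add_right_comm hl' hp hx'))) ?_
    by_cases hpU : p.1 ∈ Act.withTau U
    · rw [List.filter_cons_of_pos (by simpa using hpU)]
      refine .trans (.ax (valid_theta (valid_add (valid_add hl' hx') hp) L U h) (valid_add ih.valid.1 (valid_theta hp L U h))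
        (.theta_split _ _ _ _ _ _ _ _ hα hpU)) ?_
      refine .trans (.add ih (.refl (valid_theta hp L U h))) ?_
      refine .trans (.add_right_comm ih.valid.2.1 ih.valid.2.2 (valid_theta hp L U h)) ?_
      exact .add (.add_comm ih.valid.2.1 (valid_theta hp L U h)) (.refl ih.valid.2.2)
    · rw [List.filter_cons_of_neg (by simpa using hpU)]
      exact .trans (.ax (valid_theta (valid_add (valid_add hl' hx') hp) L U h) ih.valid.1
        (.theta_drop _ _ _ _ _ _ _ _ hα hpU)) ih

open Classical in
theorem derives_theta_preSum (L U : Set A) (h : L ⊆ U) (hl : ∀ p ∈ l, p.2.Valid)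
    {p : Act A × Expr A Empty} (hp : p ∈ l) (hpL : p.1 ∈ Act.withTau L) :
    Derives (.theta L U h (preSum l)) (preSum ((l.filter fun p => p.1 ∈ Act.withTau U).map
      (thetaSummand L U h))) := by
  have hpU : p.1 ∈ Act.withTau U := by
    rcases hpL with h' | ⟨a, ha, h'⟩
    · exact .inl h'
    · exact .inr ⟨a, h ha, h'⟩
  -- Idempotence supplies a second copy of `p` to act as the witness. Since `L ⊆ U`, `p` passes the
  -- filter, so the copy is absorbed again at the end.
  refine .trans (.theta L U h (Summand.of_mem_preSum hl hp).symm) ?_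
  refine .trans (derives_theta_add L U h hl (hl p hp) hpL) ?_
  refine .trans (Summand.of_mem (fun q hq => ?_) (List.mem_map.2 ⟨p, ?_, rfl⟩)) ?_
  · obtain ⟨r, hr, rfl⟩ := List.mem_map.1 hq
    exact valid_theta (P := Expr.pre r.1 r.2) (hl r (List.mem_filter.1 hr).1) L U h
  · exact List.mem_filter.2 ⟨hp, by simpa using hpU⟩
  · rw [preSum, List.map_map]
    exact derives_sum_map fun q hq => derives_theta_pre L U h q (hl q (List.mem_filter.1 hq).1)

open Classical in
/-- The summand of `ψ_X(P)` that stems from a summand of `P`, if `P` idles under `X`. -/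
noncomputable def psiSummand (X : Set A) (p : Act A × Expr A Empty) : Act A × Expr A Empty :=
  (p.1, if p.1 = .tout then .theta X X subset_rfl p.2 else p.2)

theorem valid_psiSummand (X : Set A) (p : Act A × Expr A Empty) (hp : p.2.Valid) :
    (psiSummand X p).2.Valid := by
  unfold psiSummand
  split_ifs
  exacts [valid_theta hp _ _ _, hp]

open Classical in
-- With `α.x` kept as a witness against idling, time-outs are dropped and every other summand leaves
-- the scope of `ψ`, by `psi_split` or `psi_out` according to its label.
theorem derives_psi_add (X : Set A) (hl : ∀ p ∈ l, p.2.Valid)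
    {α : Act A} {x : Expr A Empty} (hx : x.Valid) (hα : α ∈ Act.withTau X) :
    Derives (.psi X (.add (preSum l) (.pre α x)))
      (.add (preSum (l.filter fun p => p.1 ≠ .tout)) (.pre α x)) := by
  have hx' : (Expr.pre α x).Valid := hx
  have hα' : α ≠ .tout := by rintro rfl; simp [Act.withTau, Act.ofSet] at hα
  induction l with
  | nil =>
    refine .trans (.psi _ (.nil_add hx')) (.trans ?_ (Derives.nil_add hx').symm)
    exact .ax (valid_psi hx' X) hx' (.psi_pre _ _ _ hα')
  | cons p l ih =>
    have hp : (Expr.pre p.1 p.2).Valid := hl p (by simp)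
    have hl : ∀ q ∈ l, q.2.Valid := fun q hq => hl q (by simp [hq])
    have hl' := valid_preSum hl
    have ih := ih hl
    refine .trans (.psi _ ((Derives.add (.add_comm hp hl') (.refl hx')).trans
      (.add_right_comm hl' hp hx'))) ?_
    by_cases hpt : p.1 = .tout
    · rw [List.filter_cons_of_neg (by simpa using hpt)]
      rw [hpt] at hp ⊢
      exact .trans (.ax (valid_psi (valid_add (valid_add hl' hx') hp) X) ih.valid.1 (.psi_drop _ _ _ _ _ hα)) ih
    · rw [List.filter_cons_of_pos (by simpa using hpt)]
      have : Derives (.psi X (.add (.add (preSum l) (.pre α x)) (.pre p.1 p.2)))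
          (.add (.psi X (.add (preSum l) (.pre α x))) (.pre p.1 p.2)) := by
        refine .ax (valid_psi (valid_add (valid_add hl' hx') hp) X) (valid_add ih.valid.1 hp) ?_
        by_cases hpX : p.1 ∈ Act.withTau X
        · exact .psi_split _ _ _ _ _ _ hα hpX
        · exact .psi_out _ _ _ _ hpX hpt
      refine .trans this (.trans (.add ih (.refl hp)) ?_)
      refine .trans (.add_right_comm ih.valid.2.1 ih.valid.2.2 hp) ?_
      exact .add (.add_comm ih.valid.2.1 hp) (.refl ih.valid.2.2)

open Classical in
theorem derives_psi_preSum (X : Set A) (hl : ∀ p ∈ l, p.2.Valid)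
    {p : Act A × Expr A Empty} (hp : p ∈ l) (hpX : p.1 ∈ Act.withTau X) :
    Derives (.psi X (preSum l)) (preSum (l.filter fun p => p.1 ≠ .tout)) := by
  refine .trans (.psi X (Summand.of_mem_preSum hl hp).symm) ?_
  refine .trans (derives_psi_add X hl (hl p hp) hpX) ?_
  refine Summand.of_mem_preSum (fun q hq => hl q (List.mem_filter.1 hq).1)
    (List.mem_filter.2 ⟨hp, ?_⟩)
  rw [decide_eq_true_iff]
  rintro h
  simp [h, Act.withTau, Act.ofSet] at hpX

theorem derives_psi_add_of_not_mem (X : Set A) (hl : ∀ p ∈ l, p.2.Valid)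
    (hlX : ∀ p ∈ l, p.1 ∉ Act.withTau X ∧ p.1 ≠ .tout) {x : Expr A Empty} (hx : x.Valid) :
    Derives (.psi X (.add (preSum l) x)) (.add (preSum l) (.psi X x)) := by
  have hx' := valid_psi hx X
  induction l with
  | nil => exact .trans (.psi _ (.nil_add hx)) (Derives.nil_add hx').symm
  | cons p l ih =>
    have hp : (Expr.pre p.1 p.2).Valid := hl p (by simp)
    have hl : ∀ q ∈ l, q.2.Valid := fun q hq => hl q (by simp [hq])
    have hl' := valid_preSum hl
    have ih := ih hl fun q hq => hlX q (by simp [hq])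
    refine .trans (.psi _ ((Derives.add (.add_comm hp hl') (.refl hx)).trans
      (.add_right_comm hl' hp hx))) ?_
    have hpX := hlX p (by simp)
    refine .trans (.ax (valid_psi (valid_add (valid_add hl' hx) hp) X) (valid_add ih.valid.1 hp)
      (.psi_out _ _ _ _ hpX.1 hpX.2)) ?_
    refine .trans (.add ih (.refl hp)) ?_
    exact .trans (.add_right_comm hl' hx' hp) (.add (.add_comm hl' hp) (.refl hx'))

theorem derives_preSum_of_mem_iff {m : List (Act A × Expr A Empty)} (hl : ∀ p ∈ l, p.2.Valid)
    (h : ∀ p, p ∈ l ↔ p ∈ m) : Derives (preSum l) (preSum m) :=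
  derives_sum
    (List.forall_mem_map.2 fun p hp => ⟨_, List.mem_map_of_mem ((h p).1 hp), .refl (hl p hp)⟩)
    (List.forall_mem_map.2 fun p hp =>
      ⟨_, List.mem_map_of_mem ((h p).2 hp), .refl (hl p ((h p).2 hp))⟩)

/-- The axiom `psi_tout` handles only pure sums of time-outs, so the list is separated into the
other summands `m`, which are moved out first, and the time-out targets `k`. -/
theorem derives_psi_preSum_of_idle (X : Set A) (hl : ∀ p ∈ l, p.2.Valid)
    (hlX : ∀ p ∈ l, p.1 ∉ Act.withTau X) :
    Derives (.psi X (preSum l)) (preSum (l.map (psiSummand X))) := by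
  classical
  set m := l.filter fun p => p.1 ≠ .tout with hm
  set k := (l.filter fun p => p.1 = .tout).map Prod.snd with hk
  have hml : ∀ p ∈ m, p ∈ l := fun p hp => (List.mem_filter.1 hp).1
  have hkl : ∀ x, x ∈ k ↔ (.tout, x) ∈ l := by simp [hk]
  have hkv : ∀ x ∈ k, x.Valid := fun x hx => hl _ ((hkl x).1 hx)
  have hkv₁ : ∀ p ∈ k.map fun y => ((.tout, y) : Act A × Expr A Empty), p.2.Valid := List.forall_mem_map.2 hkv
  have hkv₂ : ∀ p ∈ k.map fun y =>
      ((.tout, theta X X subset_rfl y) : Act A × Expr A Empty), p.2.Valid :=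
    List.forall_mem_map.2 fun x hx => valid_theta (hkv x hx) _ _ _
  have hmv : ∀ p ∈ m, p.2.Valid := fun p hp => hl p (hml p hp)
  have h₁ : Derives (preSum l) (.add (preSum m) (preSum (k.map fun y => (.tout, y)))) := by
    refine .trans (derives_preSum_of_mem_iff hl ?_) (derives_preSum_append hmv hkv₁)
    rintro ⟨α, x⟩
    simp only [hm, List.mem_append, List.mem_filter, List.mem_map, hkl]
    grind
  refine .trans (.psi X h₁) ?_
  refine .trans (derives_psi_add_of_not_mem X hmv (fun p hp => ⟨hlX p (hml p hp), ?_⟩)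
    (valid_preSum hkv₁)) ?_
  · simpa using (List.mem_filter.1 hp).2
  refine .trans (.add (.refl (valid_preSum hmv))
    (.ax (valid_psi (valid_preSum hkv₁) X) (valid_preSum hkv₂) (.psi_tout X k))) ?_
  refine .trans (derives_preSum_append hmv hkv₂).symm (derives_preSum_of_mem_iff ?_ ?_)
  · intro p hp
    exact (List.mem_append.1 hp).elim (hmv p) (hkv₂ p)
  rintro ⟨α, x⟩
  simp only [hm, List.mem_append, List.mem_filter, List.mem_map, hkl, psiSummand]
  grind

open Classical in
/-- The transitions of `P ∥_S Q`, given those of `P` and `Q`. -/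
noncomputable def parSummands (S : Set A) (P Q : Expr A Empty) (l m : List (Act A × Expr A Empty)) :
    List (Act A × Expr A Empty) :=
  ((l.filter fun p => p.1 ∉ Act.ofSet S).map fun p => (p.1, .par S p.2 Q)) ++
  ((m.filter fun q => q.1 ∉ Act.ofSet S).map fun q => (q.1, .par S P q.2)) ++
  (((l.product m).filter fun r => r.1.1 = r.2.1 ∧ r.1.1 ∈ Act.ofSet S).map
    fun r => (r.1.1, .par S r.1.2 r.2.2))

theorem valid_parSummands (S : Set A) {P Q : Expr A Empty} (hP : P.Valid) (hQ : Q.Valid)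
    {m : List (Act A × Expr A Empty)} (hl : ∀ p ∈ l, p.2.Valid) (hm : ∀ p ∈ m, p.2.Valid) :
    ∀ p ∈ parSummands S P Q l m, p.2.Valid := by
  intro p hp
  simp only [parSummands, List.mem_append, List.mem_map, List.mem_filter] at hp
  rcases hp with (⟨q, ⟨hq, -⟩, rfl⟩ | ⟨q, ⟨hq, -⟩, rfl⟩) | ⟨q, ⟨hq, -⟩, rfl⟩
  · exact ⟨hl q hq, hQ⟩
  · exact ⟨hP, hm q hq⟩
  · exact ⟨hl _ (List.pair_mem_product.1 hq).1, hm _ (List.pair_mem_product.1 hq).2⟩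

/-- The expansion axiom leaves whole sums as residual components. Congruence below the prefixes puts
`P` and `Q` back, so that the summands are literally the targets of transitions. -/
theorem derives_par_preSum (S : Set A) {P Q : Expr A Empty} {m : List (Act A × Expr A Empty)}
    (hl : ∀ p ∈ l, p.2.Valid) (hm : ∀ p ∈ m, p.2.Valid) (hP : Derives P (preSum l))
    (hQ : Derives Q (preSum m)) : Derives (.par S P Q) (preSum (parSummands S P Q l m)) := by
  classical
  have hv := valid_parSummands S hP.valid.1 hQ.valid.1 hl hm
  have key : Derives (expansion S l m) (preSum (parSummands S P Q l m)) := by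
    simp only [parSummands, List.forall_mem_append] at hv
    refine .symm (.trans (derives_preSum_append (List.forall_mem_append.2 hv.1) hv.2)
      (.add (.trans (derives_preSum_append hv.1.1 hv.1.2) (.add ?_ ?_)) ?_)) <;>
      rw [preSum, List.map_map] <;> refine derives_sum_map fun p hp => .pre _ ?_ <;>
      have hp := (List.mem_filter.1 hp).1
    · exact .par _ (.refl (hl p hp)) hQ
    · exact .par _ hP (.refl (hm p hp))
    · exact .par _ (.refl (hl _ (List.pair_mem_product.1 hp).1))
        (.refl (hm _ (List.pair_mem_product.1 hp).2))
  exact .trans (.par S hP hQ) (.trans (.ax ⟨hP.valid.2, hQ.valid.2⟩ key.valid.1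
    (.expansion S l m)) key)

end Sums

/-! ### Transitions and head normal forms -/

theorem Idle.anti {T T' : Expr A Empty → Act A → Expr A Empty → Prop}
    (h : ∀ P α Q, T P α Q → T' P α Q) {X : Set A} {P : Expr A Empty} (hP : Idle T' X P) :
    Idle T X P := fun α hα Q hQ => hP α hα Q (h _ _ _ hQ)

/-- The relation `T` is consulted only in the idling premises, which are negative. -/
theorem Rules.anti {T T' : Expr A Empty → Act A → Expr A Empty → Prop}
    (h : ∀ P α Q, T P α Q → T' P α Q) {P : Expr A Empty} {α : Act A} {Q : Expr A Empty}
    (hP : Rules T' P α Q) : Rules T P α Q := by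
  induction hP with
  | pre α P => exact .pre α P
  | addL _ _ ih => exact .addL _ ih
  | addR _ _ ih => exact .addR _ ih
  | renVis _ _ _ hR ih => exact .renVis _ _ ih hR
  | renTau _ _ _ ih => exact .renTau _ _ ih
  | renTout _ _ _ ih => exact .renTout _ _ ih
  | parL _ _ hα ih => exact .parL _ ih hα
  | parR _ _ hα ih => exact .parR _ ih hα
  | sync _ _ ha ih₁ ih₂ => exact .sync ih₁ ih₂ ha
  | hideOut _ hα ih => exact .hideOut ih hα
  | hideIn _ ha ih => exact .hideIn ih ha
  | fix _ ih => exact .fix ih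
  | thetaTau _ _ ih => exact .thetaTau _ ih
  | thetaVis _ _ ha ih => exact .thetaVis _ ih ha
  | thetaIdle _ _ hP ih => exact .thetaIdle _ ih (hP.anti h)
  | psi _ hα ih => exact .psi ih hα
  | psiTout _ hP ih => exact .psiTout ih (hP.anti h)

theorem rules_rules_step_le {P : Expr A Empty} {α : Act A} {Q : Expr A Empty}
    (h : Rules (Rules Step) P α Q) : Step P α Q := fun T hT =>
  hT _ _ _ (Rules.anti (fun _ _ _ h' => Rules.anti (fun _ _ _ h'' => h'' T hT) h') h)

/-- Knaster–Tarski: a monotone operator maps its least pre-fixed point to a pre-fixed point. -/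
theorem rules_rules_step : Rules (Rules Step) = (Step : Expr A Empty → Act A → _ → Prop) := by
  ext P α Q
  exact ⟨rules_rules_step_le, fun h => h _ fun _ _ _ h' =>
    Rules.anti (fun _ _ _ h₁ => Rules.anti (fun _ _ _ h₂ => rules_rules_step_le h₂) h₁) h'⟩

theorem Rules.valid {T : Expr A Empty → Act A → Expr A Empty → Prop} {P : Expr A Empty}
    {α : Act A} {Q : Expr A Empty} (h : Rules T P α Q) (hP : P.Valid) : Q.Valid := by
  induction h with
  | pre α P => exact hP
  | addL _ _ ih => exact ih hP.1
  | addR _ _ ih => exact ih hP.2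
  | renVis _ _ _ hR ih => exact ih hP
  | renTau _ _ _ ih => exact ih hP
  | renTout _ _ _ ih => exact ih hP
  | parL _ _ hα ih => exact ⟨ih hP.1, hP.2⟩
  | parR _ _ hα ih => exact ⟨hP.1, ih hP.2⟩
  | sync _ _ ha ih₁ ih₂ => exact ⟨ih₁ hP.1, ih₂ hP.2⟩
  | hideOut _ hα ih => exact ih hP
  | hideIn _ ha ih => exact ih hP
  | fix _ ih => exact ih hP.inst
  | thetaTau _ _ ih => exact valid_theta (ih hP.2) _ _ _
  | thetaVis _ _ ha ih => exact ih hP.2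
  | thetaIdle _ _ _ ih => exact ih hP.2
  | psi _ hα ih => exact ih hP.2
  | psiTout _ _ ih => exact valid_theta (ih hP.2) _ _ _

theorem Rules.guarded {T : Expr A Empty → Act A → Expr A Empty → Prop} {P : Expr A Empty}
    {α : Act A} {Q : Expr A Empty} (h : Rules T P α Q) (hP : Guarded P) : Guarded Q := by
  induction h with
  | pre α P => exact hP
  | addL _ _ ih => exact ih hP.1
  | addR _ _ ih => exact ih hP.2
  | renVis _ _ _ hR ih => exact ih hP
  | renTau _ _ _ ih => exact ih hP
  | renTout _ _ _ ih => exact ih hP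
  | parL _ _ hα ih => exact ⟨ih hP.1, hP.2⟩
  | parR _ _ hα ih => exact ⟨hP.1, ih hP.2⟩
  | sync _ _ ha ih₁ ih₂ => exact ⟨ih₁ hP.1, ih₂ hP.2⟩
  | hideOut _ hα ih => exact ih hP
  | hideIn _ ha ih => exact ih hP
  | fix _ ih => exact ih hP.inst
  | thetaTau _ _ ih => exact ih hP
  | thetaVis _ _ ha ih => exact ih hP
  | thetaIdle _ _ _ ih => exact ih hP
  | psi _ hα ih => exact ih hP
  | psiTout _ _ ih => exact ih hP

/-- The list `l` is a head normal form of `P`: `P` is derivably equal to `∑ αᵢ.Pᵢ`, where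
the `(αᵢ, Pᵢ)` are the transitions of `P`, both in the least and the greatest fixed point of
the operator of the well-founded semantics. -/
structure IsHnf (P : Expr A Empty) (l : List (Act A × Expr A Empty)) : Prop where
  valid : ∀ p ∈ l, p.2.Valid
  derives : Derives P (preSum l)
  rules : ∀ T, T = Step ∨ T = Rules Step → ∀ α Q, Rules T P α Q ↔ (α, Q) ∈ l

namespace IsHnf

variable {P Q : Expr A Empty} {l m : List (Act A × Expr A Empty)}

/-- Since `Step = Rules (Rules Step)`, idling with respect to one of the two relations is decided by
the clause `rules` for the other. This is why head normal forms carry both. -/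
theorem idle (h : IsHnf P l) {T : Expr A Empty → Act A → Expr A Empty → Prop}
    (hT : T = Step ∨ T = Rules Step) (X : Set A) :
    Idle T X P ↔ ∀ p ∈ l, p.1 ∉ Act.withTau X := by
  have : ∀ α Q, T P α Q ↔ (α, Q) ∈ l := by
    rcases hT with rfl | rfl
    · rw [← rules_rules_step]; exact h.rules _ (.inr rfl)
    · exact h.rules _ (.inl rfl)
  simp only [Idle, this]
  exact ⟨fun h p hp hX => h p.1 hX p.2 hp, fun h α hα Q hQ => h _ hQ hα⟩

theorem nil : IsHnf (.nil : Expr A Empty) [] where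
  valid := by simp
  derives := .refl trivial
  rules T _ α Q := by
    simp only [List.not_mem_nil, iff_false]
    intro h; cases h

theorem pre (α : Act A) (hP : P.Valid) : IsHnf (.pre α P) [(α, P)] where
  valid := by simpa
  derives := (Derives.add_nil (P := .pre α P) hP).symm
  rules T _ β Q := by
    simp only [List.mem_singleton, Prod.mk.injEq]
    constructor
    · intro h; cases h; exact ⟨rfl, rfl⟩
    · rintro ⟨rfl, rfl⟩; exact .pre _ _

theorem add (hP : IsHnf P l) (hQ : IsHnf Q m) : IsHnf (.add P Q) (l ++ m) where
  valid := List.forall_mem_append.2 ⟨hP.valid, hQ.valid⟩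
  derives := .trans (.add hP.derives hQ.derives) (derives_preSum_append hP.valid hQ.valid).symm
  rules T hT α R := by
    rw [List.mem_append, ← hP.rules T hT, ← hQ.rules T hT]
    constructor
    · rintro (_ | _)
      exacts [.inl ‹_›, .inr ‹_›]
    · rintro (h | h)
      exacts [.addL _ h, .addR _ h]

theorem par (S : Set A) (hP : IsHnf P l) (hQ : IsHnf Q m) :
    IsHnf (.par S P Q) (parSummands S P Q l m) where
  valid := valid_parSummands S hP.derives.valid.1 hQ.derives.valid.1 hP.valid hQ.valid
  derives := derives_par_preSum S hP.valid hQ.valid hP.derives hQ.derives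
  rules T hT α R := by
    simp only [parSummands, List.mem_append, List.mem_map, List.mem_filter, Prod.exists,
      List.pair_mem_product, ← hP.rules T hT, ← hQ.rules T hT, Prod.mk.injEq, decide_eq_true_eq]
    constructor
    · intro h
      cases h with
      | parL _ h hα => exact .inl (.inl ⟨_, _, ⟨h, hα⟩, rfl, rfl⟩)
      | parR _ h hα => exact .inl (.inr ⟨_, _, ⟨h, hα⟩, rfl, rfl⟩)
      | sync h₁ h₂ ha => exact .inr ⟨_, _, _, _, ⟨⟨h₁, h₂⟩, rfl, ⟨_, ha, rfl⟩⟩, rfl, rfl⟩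
    · rintro ((⟨β, P', ⟨h, hα⟩, rfl, rfl⟩ | ⟨β, P', ⟨h, hα⟩, rfl, rfl⟩) |
        ⟨β, P', _, Q', ⟨⟨h₁, h₂⟩, rfl, ⟨a, ha, rfl⟩⟩, rfl, rfl⟩)
      exacts [.parL _ h hα, .parR _ h hα, .sync h₁ h₂ ha]

theorem hide (I : Set A) (hP : IsHnf P l) : IsHnf (.hide I P) (l.map (hideSummand I)) where
  valid := List.forall_mem_map.2 hP.valid
  derives := .trans (.hide I hP.derives) (derives_hide_preSum I hP.valid)
  rules T hT α R := by
    simp only [hideSummand, List.mem_map, Prod.exists, ← hP.rules T hT, Prod.mk.injEq]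
    constructor
    · intro h
      cases h with
      | hideOut h hα => exact ⟨_, _, h, if_neg hα, rfl⟩
      | hideIn h ha => exact ⟨_, _, h, if_pos ⟨_, ha, rfl⟩, rfl⟩
    · rintro ⟨β, P', h, rfl, rfl⟩
      split_ifs with hβ
      · obtain ⟨a, ha, rfl⟩ := hβ
        exact .hideIn h ha
      · exact .hideOut h hβ

theorem ren (R : A → A → Prop) (hR) (hP : IsHnf P l) :
    IsHnf (.ren R hR P) (l.flatMap (renSummands R hR)) where
  valid q hq := by
    obtain ⟨p, hp, hq⟩ := List.mem_flatMap.1 hq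
    exact valid_renSummands R hR p (hP.valid p hp) q hq
  derives := .trans (.ren R hR hP.derives) (derives_ren_preSum R hR hP.valid)
  rules T hT α Q := by
    simp only [List.mem_flatMap, Prod.exists, ← hP.rules T hT]
    constructor
    · intro h
      cases h with
      | renVis _ _ h hab => exact ⟨_, _, h, by simpa [renSummands] using hab⟩
      | renTau _ _ h => exact ⟨_, _, h, by simp [renSummands]⟩
      | renTout _ _ h => exact ⟨_, _, h, by simp [renSummands]⟩
    · rintro ⟨a | _ | _, P', h, h'⟩
      · simp only [renSummands, List.mem_map, Finset.mem_toList, Set.Finite.mem_toFinset,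
          Set.mem_ofPred_eq, Prod.mk.injEq] at h'
        obtain ⟨b, hb, rfl, rfl⟩ := h'
        exact .renVis _ _ h hb
      · simp only [renSummands, List.mem_singleton, Prod.mk.injEq] at h'
        obtain ⟨rfl, rfl⟩ := h'
        exact .renTau _ _ h
      · simp only [renSummands, List.mem_singleton, Prod.mk.injEq] at h'
        obtain ⟨rfl, rfl⟩ := h'
        exact .renTout _ _ h

theorem theta_of_idle (L U : Set A) (h : L ⊆ U) (hP : IsHnf P l)
    (hl : ∀ p ∈ l, p.1 ∉ Act.withTau L) : IsHnf (.theta L U h P) l where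
  valid := hP.valid
  derives := .trans (.theta L U h hP.derives)
    (.ax (valid_theta hP.derives.valid.2 L U h) hP.derives.valid.2 (.theta_idle L U h l hl))
  rules T hT α Q := by
    constructor
    · intro h
      cases h with
      | thetaTau _ h => exact (hl _ ((hP.rules T hT _ _).1 h) (.inl rfl)).elim
      | thetaVis _ h _ => exact (hP.rules T hT _ _).1 h
      | thetaIdle _ h _ => exact (hP.rules T hT _ _).1 h
    · intro hQ
      exact .thetaIdle _ ((hP.rules T hT _ _).2 hQ) ((hP.idle hT L).2 hl)

open Classical in
theorem theta_of_mem (L U : Set A) (h : L ⊆ U) (hP : IsHnf P l) {p : Act A × Expr A Empty}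
    (hp : p ∈ l) (hpL : p.1 ∈ Act.withTau L) :
    IsHnf (.theta L U h P) ((l.filter fun p => p.1 ∈ Act.withTau U).map (thetaSummand L U h)) where
  valid := List.forall_mem_map.2 fun p hp => by
    have := hP.valid p (List.mem_filter.1 hp).1
    unfold thetaSummand
    split_ifs
    exacts [valid_theta this _ _ _, this]
  derives := .trans (.theta L U h hP.derives) (derives_theta_preSum L U h hP.valid hp hpL)
  rules T hT α Q := by
    simp only [thetaSummand, List.mem_map, List.mem_filter, decide_eq_true_eq, Prod.exists,
      ← hP.rules T hT, Prod.mk.injEq]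
    constructor
    · intro h
      cases h with
      | thetaTau _ h => exact ⟨_, _, ⟨h, .inl rfl⟩, rfl, if_pos rfl⟩
      | thetaVis _ h ha => exact ⟨_, _, ⟨h, .inr ⟨_, ha, rfl⟩⟩, rfl, if_neg (by simp)⟩
      | thetaIdle _ _ h => exact ((hP.idle hT L).1 h p hp hpL).elim
    · rintro ⟨β, P', ⟨h', hβ⟩, rfl, rfl⟩
      rcases hβ with rfl | ⟨a, ha, rfl⟩
      · rw [if_pos rfl]; exact .thetaTau _ h'
      · rw [if_neg (by simp)]; exact .thetaVis _ h' ha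

theorem psi_of_idle (X : Set A) (hP : IsHnf P l) (hl : ∀ p ∈ l, p.1 ∉ Act.withTau X) :
    IsHnf (.psi X P) (l.map (psiSummand X)) where
  valid := List.forall_mem_map.2 fun p hp => valid_psiSummand X p (hP.valid p hp)
  derives := .trans (.psi X hP.derives) (derives_psi_preSum_of_idle X hP.valid hl)
  rules T hT α Q := by
    simp only [psiSummand, List.mem_map, Prod.exists, ← hP.rules T hT, Prod.mk.injEq]
    constructor
    · intro h
      cases h with
      | psi h hα => exact ⟨_, _, h, rfl, if_neg hα⟩
      | psiTout h _ => exact ⟨_, _, h, rfl, if_pos rfl⟩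
    · rintro ⟨β, P', h', rfl, rfl⟩
      split_ifs with hβ
      · subst hβ
        exact .psiTout h' ((hP.idle hT X).2 hl)
      · exact .psi h' hβ

open Classical in
theorem psi_of_mem (X : Set A) (hP : IsHnf P l) {p : Act A × Expr A Empty}
    (hp : p ∈ l) (hpX : p.1 ∈ Act.withTau X) :
    IsHnf (.psi X P) (l.filter fun p => p.1 ≠ .tout) where
  valid p hp := hP.valid p (List.mem_filter.1 hp).1
  derives := .trans (.psi X hP.derives) (derives_psi_preSum X hP.valid hp hpX)
  rules T hT α Q := by
    simp only [List.mem_filter, decide_eq_true_eq, ← hP.rules T hT]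
    constructor
    · intro h
      cases h with
      | psi h hα => exact ⟨h, hα⟩
      | psiTout _ h => exact ((hP.idle hT X).1 h p hp hpX).elim
    · rintro ⟨h, hα⟩
      exact .psi h hα

theorem fix {W : Set ℕ} {E : W → Expr A (Empty ⊕ W)} {x : W} (hE : (Expr.fix W E x).Valid)
    (h : IsHnf (inst E (E x)) l) : IsHnf (.fix W E x) l where
  valid := h.valid
  derives := .trans (.ax hE hE.inst (.rdp W E x)) h.derives
  rules T hT α Q := by
    rw [← h.rules T hT]
    exact ⟨fun h => by cases h; assumption, .fix⟩

end IsHnf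

/-- At `θ` and `ψ` the list obtained for the argument decides the negative premise: either no label
violates idling, or some summand witnesses the violation. -/
theorem Unwindable.exists_isHnf {P : Expr A Empty} (h : Unwindable P) (hP : P.Valid) :
    ∃ l, IsHnf P l := by
  induction h with
  | nil => exact ⟨_, .nil⟩
  | pre α P => exact ⟨_, .pre α hP⟩
  | add _ _ ih₁ ih₂ =>
    obtain ⟨l, hl⟩ := ih₁ hP.1
    obtain ⟨m, hm⟩ := ih₂ hP.2
    exact ⟨_, hl.add hm⟩
  | par S _ _ ih₁ ih₂ =>
    obtain ⟨l, hl⟩ := ih₁ hP.1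
    obtain ⟨m, hm⟩ := ih₂ hP.2
    exact ⟨_, hl.par S hm⟩
  | hide I _ ih => obtain ⟨l, hl⟩ := ih hP; exact ⟨_, hl.hide I⟩
  | ren R hR _ ih => obtain ⟨l, hl⟩ := ih hP; exact ⟨_, hl.ren R hR⟩
  | theta L U h _ ih =>
    obtain ⟨l, hl⟩ := ih hP.2
    by_cases hL : ∀ p ∈ l, p.1 ∉ Act.withTau L
    · exact ⟨_, hl.theta_of_idle L U h hL⟩
    · push Not at hL
      obtain ⟨p, hp, hpL⟩ := hL
      exact ⟨_, hl.theta_of_mem L U h hp hpL⟩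
  | psi X _ ih =>
    obtain ⟨l, hl⟩ := ih hP.2
    by_cases hX : ∀ p ∈ l, p.1 ∉ Act.withTau X
    · exact ⟨_, hl.psi_of_idle X hX⟩
    · push Not at hX
      obtain ⟨p, hp, hpX⟩ := hX
      exact ⟨_, hl.psi_of_mem X hp hpX⟩
  | fix _ ih => obtain ⟨l, hl⟩ := ih hP.inst; exact ⟨_, hl.fix hP⟩

theorem Trans.guarded {P Q : Proc A} {α : Act A} (h : Trans P α Q) (hP : Guarded P.1) :
    Guarded Q.1 := by
  rw [Trans, ← rules_rules_step] at h
  exact h.guarded hP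

theorem Guarded.exists_preSum {P : Proc A} (h : Guarded P.1) : ∃ l : List (Act A × Proc A),
    Derives P.1 (preSum (l.map fun p => (p.1, p.2.1))) ∧ ∀ α Q, Trans P α Q ↔ (α, Q) ∈ l := by
  obtain ⟨l, hl⟩ := h.unwindable.exists_isHnf P.2
  -- Choosing `T = Rules Step` turns `Rules T` into `Step`.
  have hl' := hl.rules _ (.inr rfl)
  rw [rules_rules_step] at hl'
  refine ⟨l.attach.map fun p => (p.1.1, ⟨p.1.2, hl.valid _ p.2⟩), ?_, fun α Q => ?_⟩
  · rw [List.map_map]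
    convert hl.derives
    exact List.attach_map_subtype_val l
  · rw [Trans, hl']
    simp only [List.mem_map, List.mem_attach, true_and, Subtype.exists, Prod.exists]
    constructor
    · intro h
      exact ⟨α, Q.1, h, rfl⟩
    · rintro ⟨β, Q', h, h'⟩
      cases h'
      exact h

/-! ### Bisimilarity -/

theorem Bisimilar.refl (P : Proc A) : Bisimilar P P :=
  ⟨Eq, ⟨fun _ _ h => h.symm, fun _ Q _ P' h h' => ⟨Q, P', .refl, .inr (h ▸ h'), h, rfl⟩,
    fun _ Q h hP => ⟨Q, .refl, h ▸ hP⟩⟩, rfl⟩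

theorem isBisimulation_bisimilar : IsBisimulation (Bisimilar (A := A)) where
  symm := fun _ _ ⟨R, hR, h⟩ => ⟨R, hR, hR.symm _ _ h⟩
  sim := fun P Q α P' ⟨R, hR, h⟩ h' =>
    let ⟨Q₁, Q₂, h₁, h₂, h₃, h₄⟩ := hR.sim P Q α P' h h'
    ⟨Q₁, Q₂, h₁, h₂, ⟨R, hR, h₃⟩, ⟨R, hR, h₄⟩⟩
  stable := fun P Q ⟨_, hR, h⟩ h' => hR.stable P Q h h'

theorem Bisimilar.symm {P Q : Proc A} (h : Bisimilar P Q) : Bisimilar Q P :=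
  isBisimulation_bisimilar.symm P Q h

theorem Bisimilar.exists_tauPath {P Q P' : Proc A} (h : Bisimilar P Q) (hP : TauPath P P') :
    ∃ Q', TauPath Q Q' ∧ Bisimilar P' Q' := by
  induction hP with
  | refl => exact ⟨Q, .refl, h⟩
  | tail _ h₂ ih =>
    obtain ⟨Q', hQ', h'⟩ := ih
    obtain ⟨Q₁, Q₂, h₃, h₄, -, h₅⟩ := isBisimulation_bisimilar.sim _ _ _ _ h' h₂
    refine ⟨Q₂, ?_, h₅⟩
    rcases h₄ with ⟨-, rfl⟩ | h₄
    · exact hQ'.trans h₃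
    · exact (hQ'.trans h₃).tail h₄

/-- The composite relation works because the `τ`-path with which `Q` answers can itself be matched
by `R`, by `Bisimilar.exists_tauPath`. -/
theorem Bisimilar.trans {P Q R : Proc A} (h₁ : Bisimilar P Q) (h₂ : Bisimilar Q R) :
    Bisimilar P R := by
  refine ⟨fun P R => ∃ Q, Bisimilar P Q ∧ Bisimilar Q R, ⟨?_, ?_, ?_⟩, Q, h₁, h₂⟩
  · rintro P R ⟨Q, h₁, h₂⟩
    exact ⟨Q, h₂.symm, h₁.symm⟩
  · rintro P R α P' ⟨Q, h₁, h₂⟩ h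
    obtain ⟨Q₁, Q₂, h₃, h₄, h₅, h₆⟩ := isBisimulation_bisimilar.sim _ _ _ _ h₁ h
    obtain ⟨R₁, h₇, h₈⟩ := h₂.exists_tauPath h₃
    rcases h₄ with ⟨rfl, rfl⟩ | h₄
    · exact ⟨R₁, R₁, h₇, .inl ⟨rfl, rfl⟩, ⟨Q₁, h₅, h₈⟩, Q₁, h₆, h₈⟩
    · obtain ⟨R₂, R₃, h₉, h₁₀, h₁₁, h₁₂⟩ := isBisimulation_bisimilar.sim _ _ _ _ h₈ h₄
      exact ⟨R₂, R₃, Relation.ReflTransGen.trans h₇ h₉, h₁₀, ⟨Q₁, h₅, h₁₁⟩, Q₂, h₆, h₁₂⟩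
  · rintro P R ⟨Q, h₁, h₂⟩ h
    obtain ⟨Q₀, h₃, h₄⟩ := isBisimulation_bisimilar.stable _ _ h₁ h
    obtain ⟨R₁, h₅, h₆⟩ := h₂.exists_tauPath h₃
    obtain ⟨R₀, h₇, h₈⟩ := isBisimulation_bisimilar.stable _ _ h₆ h₄
    exact ⟨R₀, Relation.ReflTransGen.trans h₅ h₇, h₈⟩

/-- The stuttering lemma. -/
theorem bisimilar_of_stuttering {P P₁ Q : Proc A} (h₁ : Trans P .tau P₁) (h₂ : TauPath P₁ Q)
    (h : Bisimilar P Q) : Bisimilar P₁ P := by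
  -- It suffices to add the pair of `P` and `P₁`: `P` answers a move of `P₁` by first stepping to
  -- `P₁`, and `P₁` answers a move of `P` by first going to `Q`.
  refine ⟨fun R S => Bisimilar R S ∨ (R = P₁ ∧ S = P) ∨ (R = P ∧ S = P₁), ⟨?_, ?_, ?_⟩,
    .inr (.inl ⟨rfl, rfl⟩)⟩
  · rintro R S (h | h | h)
    exacts [.inl h.symm, .inr (.inr h.symm), .inr (.inl h.symm)]
  · rintro R S α R' (h' | ⟨rfl, rfl⟩ | ⟨rfl, rfl⟩) hR
    · obtain ⟨S₁, S₂, h₃, h₄, h₅, h₆⟩ := isBisimulation_bisimilar.sim _ _ _ _ h' hR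
      exact ⟨S₁, S₂, h₃, h₄, .inl h₅, .inl h₆⟩
    · exact ⟨_, _, .single h₁, .inr hR, .inl (.refl _), .inl (.refl _)⟩
    · obtain ⟨S₁, S₂, h₃, h₄, h₅, h₆⟩ := isBisimulation_bisimilar.sim _ _ _ _ h hR
      exact ⟨S₁, S₂, Relation.ReflTransGen.trans h₂ h₃, h₄, .inl h₅, .inl h₆⟩
  · rintro R S (h' | ⟨rfl, rfl⟩ | ⟨rfl, rfl⟩) hR
    · exact isBisimulation_bisimilar.stable _ _ h' hR
    · exact ⟨_, .single h₁, hR⟩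
    · exact (hR _ h₁).elim

/-- A transition that is not inert is matched directly by a bisimilar process without inert
transitions. -/
theorem Bisimilar.exists_trans {P Q P' : Proc A} {α : Act A} (h : Bisimilar P Q)
    (hQ : ∀ Q', Trans Q .tau Q' → ¬ Bisimilar Q' Q) (hP : Trans P α P')
    (hα : ¬ (α = .tau ∧ Bisimilar P' P)) : ∃ Q', Trans Q α Q' ∧ Bisimilar P' Q' := by
  obtain ⟨Q₁, Q₂, h₁, h₂, h₃, h₄⟩ := isBisimulation_bisimilar.sim _ _ _ _ h hP
  -- By stuttering, a nonempty path back into the class would start with an inert step of `Q`.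
  have : Q₁ = Q := by
    rcases Relation.ReflTransGen.cases_head h₁ with rfl | ⟨R, h₅, h₆⟩
    · rfl
    · exact (hQ R h₅ (bisimilar_of_stuttering h₅ h₆ (h.symm.trans h₃))).elim
  subst this
  rcases h₂ with ⟨rfl, rfl⟩ | h₂
  · exact (hα ⟨rfl, h₄.trans h₃.symm⟩).elim
  · exact ⟨Q₂, h₂, h₄⟩

/-! ### Specifications of prefix sums -/

theorem subst_preSum {V V' : Type} (σ : V → Expr A V') (l : List (Act A × Expr A V)) :
    subst σ (preSum l) = preSum (l.map fun p => (p.1, subst σ p.2)) := by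
  induction l with
  | nil => rfl
  | cons p l ih => exact congrArg (Expr.add _) ih

theorem occursUnguarded_preSum {V : Type} (v : V) (l : List (Act A × Expr A V)) :
    OccursUnguarded v (preSum l) ↔ ∃ p ∈ l, p.1 = .tau ∧ OccursUnguarded v p.2 := by
  induction l with
  | nil => simp [preSum, sum, OccursUnguarded]
  | cons p l ih => rw [List.exists_mem_cons_iff, ← ih]; rfl

theorem noHide_preSum {V : Type} (l : List (Act A × Expr A V)) :
    NoHide (preSum l) ↔ ∀ p ∈ l, NoHide p.2 := by
  induction l with
  | nil => simp [preSum, sum, NoHide]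
  | cons p l ih => rw [List.forall_mem_cons, ← ih]; rfl

theorem validRel_preSum {V : Type} (B : Set V) (l : List (Act A × Expr A V)) :
    ValidRel B (preSum l) ↔ ∀ p ∈ l, ValidRel B p.2 := by
  induction l with
  | nil => simp [preSum, sum, ValidRel]
  | cons p l ih => rw [List.forall_mem_cons, ← ih]; rfl

/-- The recursive specification `{w = ∑ αᵢ.vᵢ | w ∈ W}`, where `l w` lists the `(αᵢ, vᵢ)`. -/
def linearSpec (V : Type) {W : Set ℕ} (l : W → List (Act A × W)) (w : W) : Expr A (V ⊕ W) :=
  preSum ((l w).map fun p => (p.1, var (Sum.inr p.2)))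

theorem valid_fix_linearSpec (V : Type) {W : Set ℕ} (l : W → List (Act A × W)) (w : W) :
    (fix W (linearSpec V l) w).Valid := fun _ =>
  (validRel_preSum _ _).2 (List.forall_mem_map.2 fun _ _ => trivial)

theorem subst_linearSpec {V V' : Type} {W : Set ℕ} (l : W → List (Act A × W)) (w : W)
    (σ : V ⊕ W → Expr A V') :
    subst σ (linearSpec V l w) = preSum ((l w).map fun p => (p.1, σ (Sum.inr p.2))) := by
  rw [linearSpec, subst_preSum, List.map_map]
  rfl

/-- All variables are unfolded simultaneously. Well-founded induction along `τ` gives each `w` its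
own finite number of rounds after which no unguarded variable is left; no uniform bound is needed.
-/
theorem wellGuarded_linearSpec (V : Type) {W : Set ℕ} {l : W → List (Act A × W)}
    (hl : WellFounded fun v w => (Act.tau, v) ∈ l w) : WellGuarded (linearSpec V l) := by
  set σ : V ⊕ W → Expr A (V ⊕ W) := unfoldSubst (linearSpec V l) Set.univ with hσ
  have hσ' : ∀ w, σ (Sum.inr w) = linearSpec V l w := fun w => by simp [hσ, unfoldSubst]
  have hN : ∀ w, NoHide (linearSpec V l w) := fun w =>
    (noHide_preSum _).2 (List.forall_mem_map.2 fun _ _ => trivial)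
  have hit : ∀ n (m : List (Act A × Expr A (V ⊕ W))),
      (subst σ)^[n] (preSum m) = preSum (m.map fun p => (p.1, (subst σ)^[n] p.2)) := by
    intro n
    induction n with
    | zero => intro m; simp
    | succ n ih =>
      intro m
      rw [Function.iterate_succ_apply, subst_preSum, ih, List.map_map]
      rfl
  -- Asking for all larger `k` lets the bounds of the finitely many summands be replaced by their
  -- maximum.
  have key : ∀ w, ∃ n, ∀ k, n ≤ k → ∀ v, ¬ OccursUnguarded (Sum.inr v)
      ((subst σ)^[k] (linearSpec V l w)) := by
    intro w
    induction w using hl.induction with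
    | _ w ih =>
      have : ∀ p ∈ l w, ∃ n, p.1 = .tau → ∀ k, n ≤ k → ∀ v, ¬ OccursUnguarded (Sum.inr v)
          ((subst σ)^[k] (linearSpec V l p.2)) := by
        rintro ⟨α, v⟩ hp
        by_cases hα : α = .tau
        · subst hα
          obtain ⟨n, hn⟩ := ih v hp
          exact ⟨n, fun _ => hn⟩
        · exact ⟨0, fun h => (hα h).elim⟩
      obtain ⟨N, hN⟩ : ∃ N, ∀ p ∈ l w, p.1 = .tau → ∀ k, N ≤ k → ∀ v,
          ¬ OccursUnguarded (Sum.inr v) ((subst σ)^[k] (linearSpec V l p.2)) := by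
        generalize l w = m at this
        induction m with
        | nil => exact ⟨0, by simp⟩
        | cons p m ihm =>
          rw [List.forall_mem_cons] at this
          obtain ⟨n, hn⟩ := this.1
          obtain ⟨N, hN⟩ := ihm this.2
          refine ⟨max n N, List.forall_mem_cons.2 ⟨fun h k hk => ?_, fun q hq h k hk => ?_⟩⟩
          · exact hn h k ((le_max_left _ _).trans hk)
          · exact hN q hq h k ((le_max_right _ _).trans hk)
      -- The extra round replaces the variables of the sum by their right-hand sides.
      refine ⟨N + 1, fun k hk v => ?_⟩
      obtain ⟨k, rfl⟩ : ∃ k', k = k' + 1 := ⟨k - 1, by omega⟩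
      rw [linearSpec, hit, occursUnguarded_preSum]
      rintro ⟨q, hq, hτ, hq'⟩
      simp only [List.map_map, List.mem_map] at hq
      obtain ⟨p, hp, rfl⟩ := hq
      refine hN p hp hτ k (by omega) v ?_
      simp only [Function.comp_apply, Function.iterate_succ_apply] at hq'
      rwa [← hσ']
  choose n hn using key
  refine ⟨fun w => (subst σ)^[n w] (linearSpec V l w), fun w => ?_, fun w => ?_, fun x y =>
    hn y _ le_rfl x⟩
  · beta_reduce
    generalize n w = k
    induction k with
    | zero => exact .refl
    | succ k ih =>
      rw [Function.iterate_succ_apply']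
      exact .step _ ih
  · beta_reduce
    generalize n w = k
    induction k with
    | zero => exact hN w
    | succ k ih =>
      rw [Function.iterate_succ_apply']
      refine ih.subst ?_
      rintro (v | v)
      · trivial
      · rw [hσ']; exact hN v

/-- Solutions of a well-guarded specification of prefix sums are unique. -/
theorem derives_of_solutions {W : Set ℕ} {l : W → List (Act A × W)}
    (hl : WellFounded fun v w => (Act.tau, v) ∈ l w) {ρ ρ' : W → Expr A Empty}
    (hρ : ∀ w, Derives (ρ w) (preSum ((l w).map fun p => (p.1, ρ p.2))))
    (hρ' : ∀ w, Derives (ρ' w) (preSum ((l w).map fun p => (p.1, ρ' p.2)))) (w : W) :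
    Derives (ρ w) (ρ' w) := by
  have key : ∀ {ρ : W → Expr A Empty},
      (∀ w, Derives (ρ w) (preSum ((l w).map fun p => (p.1, ρ p.2)))) →
      Derives (ρ w) (subst (fun _ => .nil) (fix W (linearSpec ℕ l) w)) := by
    intro ρ hρ
    -- No outer variable occurs in the specification, so its instantiation by `.nil` is arbitrary.
    refine .rsp (linearSpec ℕ l) (fun _ => .nil) ρ w (valid_fix_linearSpec ℕ l)
      (wellGuarded_linearSpec ℕ hl) (fun _ => trivial) fun y => ?_
    rw [subst_linearSpec]
    exact hρ y
  exact (key hρ).trans (key hρ').symm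

/-! ### Presentations of transition systems -/

/-- The processes `s w`, for `w ∈ W`, have transitions listed by `l w`, are derivably equal to the
corresponding sums, and have no infinite path of `τ`-transitions. -/
structure IsPresentation {W : Set ℕ} (s : W → Proc A) (l : W → List (Act A × W)) : Prop where
  derives : ∀ w, Derives (s w).1 (preSum ((l w).map fun p => (p.1, (s p.2).1)))
  trans_of_mem : ∀ {w α v}, (α, v) ∈ l w → Trans (s w) α (s v)
  exists_mem : ∀ {w α Q}, Trans (s w) α Q → ∃ v, (α, v) ∈ l w ∧ s v = Q
  wf : WellFounded fun v w => (Act.tau, v) ∈ l w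

namespace IsPresentation

variable {W : Set ℕ} {s : W → Proc A} {l : W → List (Act A × W)}

/-- Each class of bisimilar states has a representative without inert transitions. -/
theorem exists_repr (h : IsPresentation s l) : ∃ r : W → W,
    (∀ w, Bisimilar (s (r w)) (s w)) ∧
    (∀ w Q, Trans (s (r w)) .tau Q → ¬ Bisimilar Q (s (r w))) ∧
    ∀ w v, Bisimilar (s w) (s v) → r w = r v := by
  let S : Setoid W := ⟨fun w v => Bisimilar (s w) (s v), fun _ => .refl _, .symm, .trans⟩
  have key : ∀ w, ∃ v, Bisimilar (s v) (s w) ∧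
      ∀ Q, Trans (s v) .tau Q → ¬ Bisimilar Q (s v) := by
    intro w
    induction w using h.wf.induction with
    | _ w ih =>
      by_cases hw : ∃ Q, Trans (s w) .tau Q ∧ Bisimilar Q (s w)
      · obtain ⟨Q, hQ, hQ'⟩ := hw
        obtain ⟨v, hv, rfl⟩ := h.exists_mem hQ
        obtain ⟨u, hu, hu'⟩ := ih v hv
        exact ⟨u, hu.trans hQ', hu'⟩
      · push Not at hw
        exact ⟨w, .refl _, hw⟩
  choose f hf hf' using key
  -- Passing through the quotient makes the choice depend on the class only.
  refine ⟨fun w => f (Quotient.mk S w).out, fun w => ?_, fun w => hf' _, fun w v hwv => ?_⟩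
  · exact (hf _).trans (Quotient.mk_out (s := S) w)
  · exact congrArg (fun q : Quotient S => f q.out) (Quotient.sound hwv)

theorem derives_of_rootedBisimilar (h : IsPresentation s l) {a b : W}
    (hab : RootedBisimilar (s a) (s b)) : Derives (s a).1 (s b).1 := by
  classical
  obtain ⟨r, hr, hr', hrr⟩ := h.exists_repr
  -- Only RDP is ever applied to these constants, so the quotient specification need not be shown
  -- well-guarded.
  set c : W → Expr A Empty := fun w =>
    fix W (linearSpec Empty fun w => (l w).map fun p => (p.1, r p.2)) (r w) with hc
  set ρ : W → Expr A Empty := fun w => preSum ((l w).map fun p => (p.1, c p.2)) with hρ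
  have hcc : ∀ {w v}, Bisimilar (s w) (s v) → c w = c v := fun h => by rw [hc]; simp only [hrr _ _ h]
  have hcv : ∀ w, (c w).Valid := fun w => valid_fix_linearSpec _ _ _
  have hlv : ∀ w, ∀ p ∈ (l w).map fun p => (p.1, c p.2), p.2.Valid := fun w =>
    List.forall_mem_map.2 fun p _ => hcv p.2
  have hρv : ∀ w, (ρ w).Valid := fun w => valid_preSum (hlv w)
  have hcρ : ∀ w, Derives (c w) (ρ (r w)) := by
    intro w
    have := Ax.rdp W (linearSpec Empty fun w => (l w).map fun p => (p.1, r p.2)) (r w)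
    rw [inst, subst_linearSpec, List.map_map] at this
    exact .ax (hcv w) (hρv (r w)) this
  have hmatch : ∀ {w v α u}, Bisimilar (s w) (s v) →
      (∀ Q, Trans (s v) .tau Q → ¬ Bisimilar Q (s v)) → (α, u) ∈ l w →
      ¬ (α = .tau ∧ Bisimilar (s u) (s w)) → (α, c u) ∈ (l v).map fun p => (p.1, c p.2) := by
    intro w v α u hwv hv hu hα
    obtain ⟨Q, hQ, hQ'⟩ := hwv.exists_trans hv (h.trans_of_mem hu) hα
    obtain ⟨u', hu', rfl⟩ := h.exists_mem hQ
    exact List.mem_map.2 ⟨_, hu', by rw [hcc hQ']⟩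
  have key : ∀ α w, Derives (pre α (c w)) (pre α (ρ w)) := by
    intro α w
    by_cases hw : ∃ u, (Act.tau, u) ∈ l w ∧ Bisimilar (s u) (s w)
    · obtain ⟨u, hu, huw⟩ := hw
      set m := ((l w).filter fun p => ¬ (p.1 = .tau ∧ Bisimilar (s p.2) (s w))).map
        fun p => (p.1, c p.2) with hm
      have hmv : ∀ p ∈ m, p.2.Valid := List.forall_mem_map.2 fun p _ => hcv p.2
      -- The list `m` holds the non-inert summands of `w`. The representative matches each of them,
      -- so `c w` absorbs them.
      have hy : Derives (add (preSum m) (c w)) (c w) := by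
        refine .trans (.add_comm (valid_preSum hmv) (hcv w)) ?_
        refine Summand.trans ?_ (.of_derives (hcρ w).symm)
        refine .sum (hρv _) (List.forall_mem_map.2 (List.forall_mem_map.2 fun p hp => ?_))
        obtain ⟨hp, hp'⟩ := List.mem_filter.1 hp
        exact Summand.of_mem_preSum (hlv _)
          (hmatch (hr w).symm (hr' w) hp (of_decide_eq_true hp'))
      have hτ : (pre Act.tau (c w)).Valid := hcv w
      have hρw : Derives (add (pre .tau (c w)) (preSum m)) (ρ w) := by
        refine derives_preSum_of_mem_iff (l := (.tau, c w) :: m)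
          (List.forall_mem_cons.2 ⟨hcv w, hmv⟩) ?_
        rintro ⟨β, x⟩
        -- All inert transitions of `w` contribute the same summand `τ.c w`, as their targets lie in
        -- the class of `w`.
        simp only [hm, List.mem_cons, List.mem_map, List.mem_filter]
        constructor
        · rintro (hx | ⟨p, ⟨hp, -⟩, hpx⟩)
          · exact ⟨_, hu, by rw [hx, hcc huw]⟩
          · exact ⟨p, hp, hpx⟩
        · rintro ⟨p, hp, hpx⟩
          by_cases hpw : p.1 = .tau ∧ Bisimilar (s p.2) (s w)
          · left; rw [← hpx, hpw.1, hcc hpw.2]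
          · exact .inr ⟨p, ⟨hp, decide_eq_true hpw⟩, hpx⟩
      refine .trans (.pre α hy.symm) (.trans ?_ (.pre α hρw))
      refine .trans ?_ (.pre α (.add (.pre .tau hy) (.refl (valid_preSum hmv))))
      -- The branching axiom with `x` the non-inert sum and `y = c w`, where `x + y` equals `c w` by
      -- `hy`.
      exact .symm (.ax (valid_pre (valid_add (valid_pre hy.valid.1 _) (valid_preSum hmv)) α)
        (valid_pre hy.valid.1 α) (.branching α (preSum m) (c w)))
    -- Without inert transitions, `w` and its representative match each other directly, so their
    -- sets of summands coincide.
    · have hw' : ∀ Q, Trans (s w) .tau Q → ¬ Bisimilar Q (s w) := by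
        intro Q hQ hQ'
        obtain ⟨u, hu, rfl⟩ := h.exists_mem hQ
        exact hw ⟨u, hu, hQ'⟩
      refine .pre α (.trans (hcρ w) (derives_preSum_of_mem_iff (hlv _) fun p => ?_))
      constructor
      · intro hp
        obtain ⟨⟨β, u⟩, hu, rfl⟩ := List.mem_map.1 hp
        refine hmatch (hr w) hw' hu ?_
        rintro ⟨rfl, hu'⟩
        exact hr' w _ (h.trans_of_mem hu) hu'
      · intro hp
        obtain ⟨⟨β, u⟩, hu, rfl⟩ := List.mem_map.1 hp
        refine hmatch (hr w).symm (hr' w) hu ?_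
        rintro ⟨rfl, hu'⟩
        exact hw ⟨u, hu, hu'⟩
  -- By `key`, every `c` below a prefix may be replaced by `ρ`, so `ρ` solves the specification of
  -- the original states.
  have hsρ : ∀ w, Derives (s w).1 (ρ w) := derives_of_solutions h.wf h.derives fun w => by
    have hw : ρ w = sum ((l w).map fun p => pre p.1 (c p.2)) := by
      simp only [hρ, preSum, List.map_map]
      rfl
    rw [hw, preSum, List.map_map]
    exact derives_sum_map fun p _ => key p.1 p.2
  refine .trans (hsρ a) (.trans (derives_preSum_of_mem_iff (hlv a) fun p => ?_) (hsρ b).symm)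
  -- The root condition matches even inert first steps by actual transitions, and bisimilar targets
  -- have the same constant `c`.
  have hroot : ∀ {a b : W}, RootedBisimilar (s a) (s b) →
      p ∈ ((l a).map fun p => (p.1, c p.2)) → p ∈ (l b).map fun p => (p.1, c p.2) := by
    rintro a b ⟨R, hR, hab⟩ hp
    obtain ⟨⟨β, u⟩, hu, rfl⟩ := List.mem_map.1 hp
    obtain ⟨Q, hQ, hQ'⟩ := hR.sim _ _ _ _ hab (h.trans_of_mem hu)
    obtain ⟨u', hu', rfl⟩ := h.exists_mem hQ
    exact List.mem_map.2 ⟨_, hu', by rw [hcc hQ']⟩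
  exact ⟨hroot hab, hroot (let ⟨R, hR, h⟩ := hab; ⟨R, hR, hR.symm _ _ h⟩)⟩

end IsPresentation

/-! ### Reachable states of strongly guarded processes -/

theorem StronglyGuarded.trans {P Q : Proc A} {α : Act A} (hP : StronglyGuarded P)
    (h : Trans P α Q) : StronglyGuarded Q :=
  ⟨h.guarded hP.1, fun ⟨f, hf, hf'⟩ => hP.2 ⟨f, .head ⟨α, h⟩ hf, hf'⟩⟩

theorem StronglyGuarded.reachable {P Q : Proc A} (hP : StronglyGuarded P) (h : Reachable P Q) :
    StronglyGuarded Q := by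
  induction h with
  | refl => exact hP
  | tail _ h ih => obtain ⟨α, h⟩ := h; exact ih.trans h

/-- Head normal forms are finite, so the transition system is finitely branching, and the states
reachable in `n` steps can be collected by recursion on `n`. -/
theorem StronglyGuarded.countable_reachable {P : Proc A} (hP : StronglyGuarded P) :
    {Q | Reachable P Q}.Countable := by
  let F : Set (Proc A) → Set (Proc A) := fun X => ⋃ Q ∈ X, {Q' | ∃ α, Trans Q α Q'}
  have hF : ∀ n : ℕ, (F^[n] {P}).Countable ∧ ∀ Q ∈ F^[n] {P}, StronglyGuarded Q := by
    intro n
    induction n with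
    | zero => exact ⟨Set.countable_singleton P, by simpa⟩
    | succ n ih =>
      rw [Function.iterate_succ_apply']
      refine ⟨ih.1.biUnion fun Q hQ => ?_, fun Q' hQ' => ?_⟩
      · obtain ⟨l, -, hl⟩ := (ih.2 Q hQ).1.exists_preSum
        refine ((l.map Prod.snd).finite_toSet.countable).mono ?_
        rintro Q' ⟨α, h⟩
        exact List.mem_map.2 ⟨_, (hl α Q').1 h, rfl⟩
      · obtain ⟨Q, hQ, α, h⟩ := Set.mem_iUnion₂.1 hQ'
        exact (ih.2 Q hQ).trans h
  refine (Set.countable_iUnion fun n => (hF n).1).mono fun Q hQ => Set.mem_iUnion.2 ?_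
  induction hQ with
  | refl => exact ⟨0, rfl⟩
  | @tail Q Q' _ h ih =>
    obtain ⟨n, hn⟩ := ih
    refine ⟨n + 1, ?_⟩
    rw [Function.iterate_succ_apply']
    exact Set.mem_biUnion hn h

/-- Countability matters because the states must be indexed by variables of a specification, which
are natural numbers. -/
theorem exists_isPresentation {X : Set (Proc A)} (hX : X.Countable)
    (hg : ∀ P ∈ X, StronglyGuarded P) (hc : ∀ P ∈ X, ∀ α Q, Trans P α Q → Q ∈ X) :
    ∃ (W : Set ℕ) (s : W → Proc A) (l : W → List (Act A × W)),
      IsPresentation s l ∧ ∀ P ∈ X, ∃ w, s w = P := by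
  have := hX.to_subtype
  obtain ⟨f, hf⟩ := exists_injective_nat X
  let e : X ≃ Set.range f := Equiv.ofInjective f hf
  let s : Set.range f → Proc A := fun w => (e.symm w).1
  have hs : ∀ P (hP : P ∈ X), s (e ⟨P, hP⟩) = P := fun P hP => by simp [s]
  have key : ∀ w, ∃ l : List (Act A × Set.range f),
      Derives (s w).1 (preSum (l.map fun p => (p.1, (s p.2).1))) ∧
      ∀ α Q, Trans (s w) α Q ↔ ∃ v, (α, v) ∈ l ∧ s v = Q := by
    intro w
    obtain ⟨m, hm, hm'⟩ := (hg _ (e.symm w).2).1.exists_preSum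
    have hmX : ∀ p ∈ m, p.2 ∈ X := fun p hp => hc _ (e.symm w).2 p.1 p.2 ((hm' _ _).2 hp)
    refine ⟨m.attach.map fun p => (p.1.1, e ⟨p.1.2, hmX _ p.2⟩), ?_, fun α Q => ?_⟩
    · rw [List.map_map]
      have hm₁ : m.attach.map (fun p => (p.1.1, p.1.2.1)) = m.map fun p => (p.1, p.2.1) :=
        List.attach_map_val (f := fun p : Act A × Proc A => (p.1, p.2.1))
      rw [← hm₁] at hm
      convert hm using 4 with p
      exact congrArg (fun Q : Proc A => (p.1.1, Q.1)) (hs _ (hmX _ p.2))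
    · rw [hm']
      constructor
      · intro h
        exact ⟨e ⟨Q, hmX _ h⟩, List.mem_map.2 ⟨⟨_, h⟩, List.mem_attach _ _, rfl⟩, hs _ _⟩
      · rintro ⟨v, hv, rfl⟩
        obtain ⟨⟨⟨β, Q⟩, hp⟩, -, hp'⟩ := List.mem_map.1 hv
        simp only [Prod.mk.injEq] at hp'
        obtain ⟨rfl, rfl⟩ := hp'
        rwa [hs]
  choose l hl hl' using key
  refine ⟨_, s, l, ⟨hl, fun h => (hl' _ _ _).2 ⟨_, h, rfl⟩, (hl' _ _ _).1, ?_⟩,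
    fun P hP => ⟨_, hs P hP⟩⟩
  -- A descending chain would be an infinite `τ`-path from a strongly guarded state.
  rw [wellFounded_iff_isEmpty_descending_chain]
  refine ⟨fun ⟨g, hg'⟩ => (hg _ (e.symm (g 0)).2).2 ⟨fun n => s (g n), .refl, fun n => ?_⟩⟩
  exact (hl' _ _ _).2 ⟨_, hg' n, rfl⟩

end CCSP

theorem mainTheorem4 {A : Type*} (P Q : CCSP.Proc A)
    (hP : CCSP.StronglyGuarded P) (hQ : CCSP.StronglyGuarded Q)
    (h : CCSP.RootedBisimilar P Q) : CCSP.Derives P.1 Q.1 := by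
  -- Both state spaces go into one presentation, so that bisimilarity classes range across them.
  obtain ⟨W, s, l, hs, hX⟩ := CCSP.exists_isPresentation
    (hP.countable_reachable.union hQ.countable_reachable)
    (fun R hR => hR.elim (hP.reachable ·) (hQ.reachable ·))
    (fun R hR α R' h => hR.imp (fun h' => .tail h' ⟨α, h⟩) (fun h' => .tail h' ⟨α, h⟩))
  obtain ⟨a, rfl⟩ := hX P (.inl .refl)
  obtain ⟨b, rfl⟩ := hX Q (.inr .refl)
  exact hs.derives_of_rootedBisimilar h
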